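/- Let $R$ be a unital (not necessarily commutative) ring and let $E=(E^0,E^1,\mathrm r,\mathrm s)$ be a directed graph with $E^0\neq\emptyset$ (no finiteness is assumed). The Leavitt path algebra $L_R(E)$ is the (not necessarily unital) free $R$-algebra on the symbols $v\in E^0$ and $\alpha,\alpha^*$ for $\alpha\in E^1$, with $R$ commuting with these generators, subject to the relations (1) $vv'=\delta_{v,v'}v$ for $v,v'\in E^0$; (2) $\mathrm s(\alpha)\alpha=\alpha\,\mathrm r(\alpha)=\alpha$ and $\mathrm r(\alpha)\alpha^*=\alpha^*\mathrm s(\alpha)=\alpha^*$ for $\alpha\in E^1$; (3) $\alpha^*\beta=\delta_{\alpha,\beta}\,\mathrm r(\alpha)$ for $\alpha,\beta\in E^1$; (4) $\sum_{\mathrm s(\alpha)=v}\alpha\alpha^*=v$ for every $v\in E^0$ such that $\mathrm s^{-1}(v)$ is finite and nonempty. Let $I$ be a set and let $S=B\cup\{0\}$, $B=\{(i,n,j) : i,j\in I,\ n\in\mathbb Z\}$, be the Brandt semigroup over the additive group $\mathbb Z$ with index set $I$: $(i,m,j)(k,n,l)=(i,m+n,l)$ if $j=k$, all other products are $0$, and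 $(i,n,j)^{-1}=(j,-n,i)$. Let $w$ assign to every vertex an element of $B$ of the form $(i,0,i)$, to every edge an element of $B$ of the form $(i,1,j)$, and to every ghost edge $\alpha^*$ an element of $B$, such that w1) $w(\mathrm s(\alpha))w(\alpha)=w(\alpha)=w(\alpha)w(\mathrm r(\alpha))$ for every edge $\alpha$; w2) $w(\alpha^*)=w(\alpha)^{-1}$ for every edge $\alpha$; w3) any two edges whose sources have the same weight have the same weight; w4) any two edges whose ranges have the same weight have the same weight. Extend $w$ multiplicatively to all products $\mu\eta^*$, where $\mu,\eta$ are paths (possibly of length zero, i.e. vertices) with $\mathrm r(\mu)=\mathrm r(\eta)$ and $(\beta_1\cdots\beta_k)^*=\beta_k^*\cdots\beta_1^*$, $v^*=v$. For $0\ne s\in S$ let $L_R(E)_s$ be the set of all finite sums $\sum_i r_i\mu_i\eta_i^*$ with $r_i\in R$, $\mathrm r(\mu_i)=\mathrm r(\eta_i)$ and $w(\mu_i\eta_i^*)=s$, and let $L_R(E)_0=0$. Then $L_R(E)=\bigoplus_{s\in S}L_R(E)_s$ is an $S$-graded ring, that is, $L_R(E)_sL_R(E)_t\subseteq L_R(E)_{st}$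 for all $s,t\in S$ (such a ring is called canonically $S$-graded); and $L_R(E)$ with this grading is graded von Neumann regular (for every $s\in S$ and every $x\in L_R(E)_s$ one has $x\in xL_R(E)x$) if and only if $R$ is von Neumann regular ($x\in xRx$ for every $x\in R$). -/

import Mathlib

universe u v w x y

/-- A (not necessarily unital or commutative) ring is von Neumann regular if `a ∈ aAa` for every
`a`. -/
def IsVonNeumannRegular (A : Type*) [Mul A] : Prop :=
  ∀ a : A, ∃ b : A, a = a * b * a

/-! ### Brandt semigroups -/

/-- The Brandt semigroup `S = M(G, I) ∪ {0}` over an additively written group `G` with index set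
`I`. The nonzero elements are the triples `(i, g, j)`, which form the Brandt groupoid `M(G, I)`. -/
inductive BrandtSemigroup (G : Type u) (I : Type v) : Type max u v
  | zero : BrandtSemigroup G I
  | triple (i : I) (g : G) (j : I) : BrandtSemigroup G I

namespace BrandtSemigroup

variable {G : Type u} {I : Type v}

instance : Zero (BrandtSemigroup G I) := ⟨zero⟩

open Classical in
/-- `(i, g, j) (k, h, l) = (i, g + h, l)` if `j = k`; all other products are zero. -/
noncomputable instance [Add G] : Mul (BrandtSemigroup G I) where
  mul
    | triple i g j, triple k h l => if j = k then triple i (g + h) l else zero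
    | _, _ => zero

/-- `(i, g, j)⁻¹ = (j, -g, i)`. -/
instance [Neg G] : Inv (BrandtSemigroup G I) where
  inv
    | triple i g j => triple j (-g) i
    | zero => zero

open Classical in
theorem triple_mul_triple [Add G] (i : I) (g : G) (j k : I) (h : G) (l : I) :
    (triple i g j * triple k h l : BrandtSemigroup G I) =
      if j = k then triple i (g + h) l else 0 := rfl

theorem inv_triple [Neg G] (i : I) (g : G) (j : I) :
    (triple i g j : BrandtSemigroup G I)⁻¹ = triple j (-g) i := rfl

theorem triple_ne_zero (i : I) (g : G) (j : I) : (triple i g j : BrandtSemigroup G I) ≠ 0 :=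
  fun h => BrandtSemigroup.noConfusion rfl rfl (heq_of_eq h)

protected theorem zero_mul [Add G] (s : BrandtSemigroup G I) : 0 * s = 0 := rfl

protected theorem mul_zero [Add G] (s : BrandtSemigroup G I) : s * 0 = 0 := by
  cases s <;> rfl

noncomputable instance [AddGroup G] : SemigroupWithZero (BrandtSemigroup G I) where
  zero_mul := BrandtSemigroup.zero_mul
  mul_zero := BrandtSemigroup.mul_zero
  mul_assoc a b c := by
    classical
    rcases a with _ | ⟨i, g, j⟩
    · rfl
    rcases b with _ | ⟨k, h, l⟩
    · rfl
    rcases c with _ | ⟨m, n, o⟩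
    · exact (BrandtSemigroup.mul_zero _).trans
        (congrArg (triple i g j * ·) (BrandtSemigroup.mul_zero (triple k h l))).symm
    by_cases h₁ : j = k <;> by_cases h₂ : l = m <;>
      simp [triple_mul_triple, h₁, h₂, add_assoc, BrandtSemigroup.zero_mul,
        BrandtSemigroup.mul_zero]

end BrandtSemigroup

/-! ### Rings graded by a groupoid with zero -/

/-- The family `A` of additive subgroups makes the ring `L` an `S`-graded ring inducing `S`: `L` is
the direct sum of the `A s`, the component of `0` is zero, and `A s * A t ⊆ A (s * t)`. Here `S`
is a set with a partial binary operation, completed to a total one by adding a zero and letting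
`s * t = 0` if the product is undefined. -/
structure IsGradedInducing {S : Type*} [Mul S] [Zero S] {L : Type*} [NonUnitalRing L]
    (A : S → AddSubgroup L) : Prop where
  isInternal : open Classical in DirectSum.IsInternal A
  zero_component : A 0 = ⊥
  mul_mem : ∀ (s t : S) (a b : L), a ∈ A s → b ∈ A t → a * b ∈ A (s * t)

/-- Graded von Neumann regularity: `a ∈ aLa` for every homogeneous `a`. -/
def IsGradedVonNeumannRegular {S : Type*} {L : Type*} [NonUnitalRing L]
    (A : S → AddSubgroup L) : Prop :=
  ∀ (s : S) (a : L), a ∈ A s → ∃ b : L, a = a * b * a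

/-! ### Leavitt path algebras -/

/-- The vertices, edges and ghost edges of a directed graph. -/
inductive LeavittGen (V : Type v) [Quiver.{w} V] : Type max v w
  | vertex (a : V) : LeavittGen V
  | edge (e : Quiver.Total V) : LeavittGen V
  | ghost (e : Quiver.Total V) : LeavittGen V

/-- The edges emitted by the vertex `a`. -/
def EmittedEdge {V : Type v} [Quiver.{w} V] (a : V) : Type max v w :=
  {e : Quiver.Total V // e.left = a}

/-- A vertex is regular if it is neither a sink nor an infinite emitter. -/
def IsRegularVertex {V : Type v} [Quiver.{w} V] (a : V) : Prop :=
  Nonempty (EmittedEdge a) ∧ Finite (EmittedEdge a)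

/-- The free non-unital ring with coefficients in `R` on the vertices, edges and ghost edges. The
ring `R` need not be commutative; it commutes with the generators. -/
abbrev LeavittFree (R : Type u) [Ring R] (V : Type v) [Quiver.{w} V] : Type max u v w :=
  MonoidAlgebra R (FreeSemigroup (LeavittGen V))

/-- `LeavittFree.term r m` is the word `m` with the coefficient `r`. -/
noncomputable abbrev LeavittFree.term {R : Type u} [Ring R] {V : Type v} [Quiver.{w} V] (r : R)
    (m : FreeSemigroup (LeavittGen V)) : LeavittFree R V :=
  MonoidAlgebra.single m r

open FreeSemigroup LeavittGen LeavittFree in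
/-- The defining relations of the Leavitt path algebra. Every relation is taken with an arbitrary
coefficient `r : R`, so that the congruence they generate is one of `R`-algebras although the
free ring has no unity. -/
inductive LeavittRel (R : Type u) [Ring R] (V : Type v) [Quiver.{w} V] :
    LeavittFree R V → LeavittFree R V → Prop
  | vertex_mul_self (r : R) (a : V) :
      LeavittRel R V (term r (of (vertex a) * of (vertex a))) (term r (of (vertex a)))
  | vertex_mul_vertex (r : R) (a b : V) (h : a ≠ b) :
      LeavittRel R V (term r (of (vertex a) * of (vertex b))) 0
  | source_mul_edge (r : R) (e : Quiver.Total V) :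
      LeavittRel R V (term r (of (vertex e.left) * of (edge e))) (term r (of (edge e)))
  | edge_mul_range (r : R) (e : Quiver.Total V) :
      LeavittRel R V (term r (of (edge e) * of (vertex e.right))) (term r (of (edge e)))
  | range_mul_ghost (r : R) (e : Quiver.Total V) :
      LeavittRel R V (term r (of (vertex e.right) * of (ghost e))) (term r (of (ghost e)))
  | ghost_mul_source (r : R) (e : Quiver.Total V) :
      LeavittRel R V (term r (of (ghost e) * of (vertex e.left))) (term r (of (ghost e)))
  | ghost_mul_edge_self (r : R) (e : Quiver.Total V) :
      LeavittRel R V (term r (of (ghost e) * of (edge e))) (term r (of (vertex e.right)))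
  | ghost_mul_edge (r : R) (e f : Quiver.Total V) (h : e ≠ f) :
      LeavittRel R V (term r (of (ghost e) * of (edge f))) 0
  | sum_edge_mul_ghost (r : R) (a : V) (h : IsRegularVertex a) [Fintype (EmittedEdge a)] :
      LeavittRel R V (∑ e : EmittedEdge a, term r (of (edge e.1) * of (ghost e.1)))
        (term r (of (vertex a)))

/-- The congruence defining the Leavitt path algebra. -/
noncomputable def leavittCon (R : Type u) [Ring R] (V : Type v) [Quiver.{w} V] : RingCon (LeavittFree R V) :=
  ringConGen (LeavittRel R V)

/-- The Leavitt path algebra `L_R(E)` of the directed graph `E` with vertex type `V` and edges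
given by the quiver structure. It has a unity only if there are finitely many vertices. -/
abbrev LeavittPathAlgebra (R : Type u) [Ring R] (V : Type v) [Quiver.{w} V] : Type max u v w :=
  (leavittCon R V).Quotient

namespace LeavittPathAlgebra

variable {V : Type v} [Quiver.{w} V]

/-- A path `μ = α₁ ⋯ αₖ` as the word `s(μ) α₁ ⋯ αₖ`; a path of length zero is its vertex. -/
def pathWord {a : V} : {b : V} → Quiver.Path a b → FreeSemigroup (LeavittGen V)
  | _, .nil => .of (.vertex a)
  | _, .cons (b := b) (c := c) p e => pathWord p * .of (.edge ⟨b, c, e⟩)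

/-- The word `αₖ* ⋯ α₁* s(μ)` representing `μ*`. -/
def ghostWord {a : V} : {b : V} → Quiver.Path a b → FreeSemigroup (LeavittGen V)
  | _, .nil => .of (.vertex a)
  | _, .cons (b := b) (c := c) p e => .of (.ghost ⟨b, c, e⟩) * ghostWord p

/-- The element `r μ η*` of the Leavitt path algebra, where `μ` and `η` are paths with the same
range. -/
noncomputable def monomial {R : Type u} [Ring R] (r : R) {a b c : V} (μ : Quiver.Path a c)
    (η : Quiver.Path b c) : LeavittPathAlgebra R V :=
  ((LeavittFree.term r (pathWord μ * ghostWord η) : LeavittFree R V) : LeavittPathAlgebra R V)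

end LeavittPathAlgebra

/-! ### Weight maps and the gradings they define -/

/-- A weight map on a directed graph with values in the nonzero elements of a Brandt semigroup,
subject to the rules w1) and w2). -/
structure WeightMap (G : Type x) [AddGroup G] (I : Type y) (V : Type v) [Quiver.{w} V] where
  vertex : V → BrandtSemigroup G I
  edge : Quiver.Total V → BrandtSemigroup G I
  ghost : Quiver.Total V → BrandtSemigroup G I
  vertex_ne_zero : ∀ a, vertex a ≠ 0
  isIdempotentElem_vertex : ∀ a, IsIdempotentElem (vertex a)
  edge_ne_zero : ∀ e, edge e ≠ 0
  source_mul_edge : ∀ e, vertex e.left * edge e = edge e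
  edge_mul_range : ∀ e, edge e * vertex e.right = edge e
  ghost_eq : ∀ e, ghost e = (edge e)⁻¹

namespace WeightMap

variable {G : Type x} [AddGroup G] {I : Type y} {V : Type v} [Quiver.{w} V]

/-- The weight of a path is the product of the weights of its edges (and of its source). -/
noncomputable def path (ω : WeightMap G I V) {a : V} :
    {b : V} → Quiver.Path a b → BrandtSemigroup G I
  | _, .nil => ω.vertex a
  | _, .cons (b := b) (c := c) p e => ω.path p * ω.edge ⟨b, c, e⟩

/-- The weight of `μ*`. -/
noncomputable def ghostPath (ω : WeightMap G I V) {a : V} :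
    {b : V} → Quiver.Path a b → BrandtSemigroup G I
  | _, .nil => ω.vertex a
  | _, .cons (b := b) (c := c) p e => ω.ghost ⟨b, c, e⟩ * ω.ghostPath p

/-- The component of degree `s`: for `s ≠ 0` it consists of the finite sums `∑ rᵢ μᵢ ηᵢ*` with
`r(μᵢ) = r(ηᵢ)` and `w(μᵢ ηᵢ*) = s`, and the component of degree `0` is zero. -/
noncomputable def component (ω : WeightMap G I V) (R : Type u) [Ring R]
    (s : BrandtSemigroup G I) : AddSubgroup (LeavittPathAlgebra R V) :=
  AddSubgroup.closure
    {z | s ≠ 0 ∧ ∃ (r : R) (a b c : V) (μ : Quiver.Path a c) (η : Quiver.Path b c),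
      ω.path μ * ω.ghostPath η = s ∧ z = LeavittPathAlgebra.monomial r μ η}

/-- The weight map defines a canonical grading: its values are of the form `(i, 0, i)` on vertices
and `(i, 1, j)` on edges, and it satisfies the rules w3) and w4): edges starting in vertices of
the same weight have the same weight, and so have edges ending in vertices of the same weight. -/
structure IsCanonical (ω : WeightMap ℤ I V) : Prop where
  vertex_form : ∀ a, ∃ i : I, ω.vertex a = .triple i 0 i
  edge_form : ∀ e, ∃ i j : I, ω.edge e = .triple i 1 j
  edge_eq_of_source : ∀ e f : Quiver.Total V,
    ω.vertex e.left = ω.vertex f.left → ω.edge e = ω.edge f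
  edge_eq_of_range : ∀ e f : Quiver.Total V,
    ω.vertex e.right = ω.vertex f.right → ω.edge e = ω.edge f

end WeightMap

/-! The grading: every defining relation either equates expressions of the same weight or makes a
word zero. Hence sorting the words of the free ring by weight, with each part read modulo the
relations, descends to a map `decompose` on the Leavitt path algebra `L`
(`leavittCon_le_decomposeCon`). This map recovers the summands of a sum of homogeneous elements, so
the sum of the components is direct. It exhausts `L` because every word reduces to zero or to a
monomial `μη*` (`wordNull_or_wordEq`).

Regularity passes from `R` to `L`: weight `(i, n, j)` forces `|μ| - |η| = n`, so a homogeneous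
element is a finite sum of monomials with lengths `(n⁺ + t, n⁻ + t)`, `t ≤ k`. For a fixed `t` these
monomials multiply like matrix units (or vanish), and finite rectangular matrices over `R` have von
Neumann inverses by elimination of rows and columns (`isRegularPair_block`). The layers are joined
by induction on `k`, since the layer of longest paths absorbs products
(`isRegularPair_lengthFiltration`). All these inductions use McCoy's lemma: if `x - xbx` is regular,
so is `x`. Relation (4) is not needed in this direction, and the layers need not be independent.

Conversely, `r v` is homogeneous for a vertex `v`. `L` acts on the functions `V × K → R` by
operators linear for right multiplication, and `r v = (r v) y (r v)` applied to a delta function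
gives `r = r s r` (`exists_eq_mul_mul_of_vertex`). The action exists for every graph once `K` is
large enough. -/

namespace LeavittPathAlgebra

open FreeSemigroup LeavittGen

variable {R : Type u} [Ring R] {V : Type v} [Quiver.{w} V]

/-! ### Words in the Leavitt path algebra -/

/-- The class of the word `m` with coefficient `r`, as an additive function of `r`. -/
noncomputable def wordTerm (R : Type u) [Ring R] (m : FreeSemigroup (LeavittGen V)) :
    R →+ LeavittPathAlgebra R V where
  toFun r := ((LeavittFree.term r m : LeavittFree R V) : LeavittPathAlgebra R V)
  map_zero' := by
    rw [LeavittFree.term, MonoidAlgebra.single_zero, RingCon.coe_zero]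
  map_add' r s := by
    rw [LeavittFree.term, MonoidAlgebra.single_add, RingCon.coe_add]

theorem wordTerm_apply (r : R) (m : FreeSemigroup (LeavittGen V)) :
    wordTerm R m r = ((LeavittFree.term r m : LeavittFree R V) : LeavittPathAlgebra R V) := rfl

theorem wordTerm_mul_wordTerm (r s : R) (m n : FreeSemigroup (LeavittGen V)) :
    wordTerm R m r * wordTerm R n s = wordTerm R (m * n) (r * s) := by
  simp only [wordTerm_apply, LeavittFree.term, ← RingCon.coe_mul, MonoidAlgebra.single_mul_single]

theorem closure_wordTerm :
    AddSubgroup.closure {z : LeavittPathAlgebra R V | ∃ m r, z = wordTerm R m r} = ⊤ := by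
  refine eq_top_iff.2 fun z _ => ?_
  obtain ⟨x, rfl⟩ := Quotient.exists_rep z
  induction x using MonoidAlgebra.induction_linear with
  | zero => exact zero_mem _
  | add x y hx hy => exact add_mem (hx trivial) (hy trivial)
  | single m r => exact AddSubgroup.subset_closure ⟨m, r, rfl⟩

/-- The two words are equal in the Leavitt path algebra with any coefficient. -/
def WordEq (R : Type u) [Ring R] (m n : FreeSemigroup (LeavittGen V)) : Prop :=
  wordTerm R m = wordTerm R n

/-- The word is zero in the Leavitt path algebra with any coefficient. -/
def WordNull (R : Type u) [Ring R] (m : FreeSemigroup (LeavittGen V)) : Prop :=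
  wordTerm R m = 0

theorem wordTerm_mul (m n : FreeSemigroup (LeavittGen V)) (r : R) :
    wordTerm R (m * n) r = wordTerm R m r * wordTerm R n 1 := by
  rw [wordTerm_mul_wordTerm, mul_one]

theorem wordTerm_mul' (m n : FreeSemigroup (LeavittGen V)) (r : R) :
    wordTerm R (m * n) r = wordTerm R m 1 * wordTerm R n r := by
  rw [wordTerm_mul_wordTerm, one_mul]

/-- The coefficient can be put on the factor that changes while the other factor carries `1`. Thus
equality for all coefficients is a congruence on words, although `L` may have no unity. -/
theorem WordEq.mul_right {m m' : FreeSemigroup (LeavittGen V)} (h : WordEq R m m')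
    (n : FreeSemigroup (LeavittGen V)) : WordEq R (m * n) (m' * n) := by
  ext r; rw [wordTerm_mul, wordTerm_mul, h]

theorem WordEq.mul_left {m m' : FreeSemigroup (LeavittGen V)} (h : WordEq R m m')
    (n : FreeSemigroup (LeavittGen V)) : WordEq R (n * m) (n * m') := by
  ext r; rw [wordTerm_mul', wordTerm_mul', h]

theorem WordNull.mul_right {m : FreeSemigroup (LeavittGen V)} (h : WordNull R m)
    (n : FreeSemigroup (LeavittGen V)) : WordNull R (m * n) := by
  ext r; rw [wordTerm_mul, h]; simp

theorem WordNull.mul_left {m : FreeSemigroup (LeavittGen V)} (h : WordNull R m)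
    (n : FreeSemigroup (LeavittGen V)) : WordNull R (n * m) := by
  ext r; rw [wordTerm_mul', h]; simp

theorem WordEq.null {m n : FreeSemigroup (LeavittGen V)} (h : WordEq R m n) (hn : WordNull R n) :
    WordNull R m := h.trans hn

theorem wordEq_of_rel {m n : FreeSemigroup (LeavittGen V)}
    (h : ∀ r : R, LeavittRel R V (LeavittFree.term r m) (LeavittFree.term r n)) : WordEq R m n :=
  AddMonoidHom.ext fun r => (RingCon.eq _).2 (RingConGen.Rel.of _ _ (h r))

theorem wordNull_of_rel {m : FreeSemigroup (LeavittGen V)}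
    (h : ∀ r : R, LeavittRel R V (LeavittFree.term r m) 0) : WordNull R m :=
  AddMonoidHom.ext fun r => (RingCon.eq _).2 (RingConGen.Rel.of _ _ (h r))

/-! ### Products of paths -/

variable (R) in
theorem vertex_mul_pathWord {a b : V} (p : Quiver.Path a b) :
    WordEq R (of (vertex a) * pathWord p) (pathWord p) := by
  induction p with
  | nil => exact wordEq_of_rel fun r => .vertex_mul_self r a
  | cons p e ih => rw [pathWord, ← mul_assoc]; exact ih.mul_right _

variable (R) in
theorem pathWord_mul_vertex {a b : V} (p : Quiver.Path a b) :
    WordEq R (pathWord p * of (vertex b)) (pathWord p) := by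
  cases p with
  | nil => exact wordEq_of_rel fun r => .vertex_mul_self r _
  | cons p e =>
    rw [pathWord, mul_assoc]
    exact (wordEq_of_rel fun r => .edge_mul_range r ⟨_, _, e⟩).mul_left _

variable (R) in
theorem vertex_mul_ghostWord {a b : V} (p : Quiver.Path a b) :
    WordEq R (of (vertex b) * ghostWord p) (ghostWord p) := by
  cases p with
  | nil => exact wordEq_of_rel fun r => .vertex_mul_self r _
  | cons p e =>
    rw [ghostWord, ← mul_assoc]
    exact (wordEq_of_rel fun r => .range_mul_ghost r ⟨_, _, e⟩).mul_right _

variable (R) in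
theorem ghostWord_mul_vertex {a b : V} (p : Quiver.Path a b) :
    WordEq R (ghostWord p * of (vertex a)) (ghostWord p) := by
  induction p with
  | nil => exact wordEq_of_rel fun r => .vertex_mul_self r a
  | cons p e ih => rw [ghostWord, mul_assoc]; exact ih.mul_left _

variable (R) in
theorem vertex_mul_vertex {a b : V} (h : a ≠ b) :
    WordNull R (of (vertex a) * of (vertex b)) :=
  wordNull_of_rel fun r => .vertex_mul_vertex r a b h

/-- A product of words is zero if a vertex absorbed by the first on the right differs from a vertex
absorbed by the second on the left. -/
theorem WordNull.of_vertex_ne {m n : FreeSemigroup (LeavittGen V)} {a b : V}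
    (hm : WordEq R (m * of (vertex a)) m) (hn : WordEq R (of (vertex b) * n) n) (h : a ≠ b) :
    WordNull R (m * n) := by
  refine WordEq.null ((hm.mul_right n).symm.trans (hn.mul_left _).symm) ?_
  rw [mul_assoc, ← mul_assoc (of _)]
  exact ((vertex_mul_vertex R h).mul_right n).mul_left m

variable (R) in
theorem pathWord_comp {a b c : V} (p : Quiver.Path a b) (q : Quiver.Path b c) :
    WordEq R (pathWord (p.comp q)) (pathWord p * pathWord q) := by
  induction q with
  | nil => exact (pathWord_mul_vertex R p).symm
  | cons q e ih => rw [Quiver.Path.comp_cons, pathWord, pathWord, ← mul_assoc]; exact ih.mul_right _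

variable (R) in
theorem ghostWord_comp {a b c : V} (p : Quiver.Path a b) (q : Quiver.Path b c) :
    WordEq R (ghostWord (p.comp q)) (ghostWord q * ghostWord p) := by
  induction q with
  | nil => exact (vertex_mul_ghostWord R p).symm
  | cons q e ih => rw [Quiver.Path.comp_cons, ghostWord, ghostWord, mul_assoc]; exact ih.mul_left _

variable (R) in
theorem ghostWord_mul_pathWord_self {a b : V} (p : Quiver.Path a b) :
    WordEq R (ghostWord p * pathWord p) (of (vertex b)) := by
  induction p with
  | nil => exact wordEq_of_rel fun r => .vertex_mul_self r a
  | @cons b c p e ih =>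
    rw [ghostWord, pathWord, mul_assoc, ← mul_assoc (ghostWord p)]
    refine ((ih.mul_right _).mul_left _).trans ?_
    have h₁ : WordEq R (of (vertex b) * of (edge ⟨b, c, e⟩)) (of (edge ⟨b, c, e⟩)) :=
      wordEq_of_rel fun r => .source_mul_edge r ⟨b, c, e⟩
    exact (h₁.mul_left _).trans (wordEq_of_rel fun r => .ghost_mul_edge_self r ⟨b, c, e⟩)

/-- The paths of the graph `V`. -/
abbrev AnyPath (V : Type v) [Quiver.{w} V] : Type max v w := Σ a b : V, Quiver.Path a b

namespace AnyPath

/-- The range of a path. -/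
abbrev range (p : AnyPath V) : V := p.2.1
/-- The length of a path. -/
abbrev length (p : AnyPath V) : ℕ := p.2.2.length
/-- The word of a path. -/
abbrev word (p : AnyPath V) : FreeSemigroup (LeavittGen V) := pathWord p.2.2
/-- The word of the ghost path of a path. -/
abbrev ghost (p : AnyPath V) : FreeSemigroup (LeavittGen V) := ghostWord p.2.2

end AnyPath

variable (R) in
-- The last edges stand outermost in `e* (p* q) f`. If the prefixes agree, the inner product is a
-- vertex and `e* f = 0` remains with `e ≠ f`; otherwise the inner product vanishes by induction.
theorem ghostWord_mul_pathWord_of_ne {a b c d : V} (p : Quiver.Path a b) (q : Quiver.Path c d)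
    (hl : p.length = q.length) (h : (⟨a, b, p⟩ : AnyPath V) ≠ ⟨c, d, q⟩) :
    WordNull R (ghostWord p * pathWord q) := by
  induction p generalizing d with
  | nil =>
    cases q with
    | nil => exact vertex_mul_vertex R fun hac => h (by rw [hac])
    | cons q f => simp at hl
  | @cons b b' p e ih =>
    cases q with
    | nil => simp at hl
    | @cons d d' q f =>
      rw [ghostWord, pathWord, mul_assoc, ← mul_assoc (ghostWord p)]
      by_cases hpq : (⟨a, b, p⟩ : AnyPath V) = ⟨c, d, q⟩
      · cases hpq
        refine WordEq.null (((ghostWord_mul_pathWord_self R p).mul_right _).mul_left _) ?_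
        have h₁ : WordEq R (of (vertex b) * of (edge ⟨b, _, f⟩)) (of (edge ⟨b, _, f⟩)) :=
          wordEq_of_rel fun r => .source_mul_edge r ⟨b, _, f⟩
        refine (h₁.mul_left _).null (wordNull_of_rel fun r => .ghost_mul_edge r _ _ fun hef => h ?_)
        cases hef; rfl
      · exact ((ih q (by simpa using hl) hpq).mul_right _).mul_left _

variable (R) in
theorem ghost_mul_word (p q : AnyPath V) (hl : p.length = q.length) :
    WordNull R (p.ghost * q.word) ∨ p = q := by
  by_cases h : p = q
  · exact .inr h
  · exact .inl (ghostWord_mul_pathWord_of_ne R _ _ hl h)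

variable (R) in
theorem ghost_mul_word_self (p : AnyPath V) :
    WordEq R (p.ghost * p.word) (of (vertex p.range)) :=
  ghostWord_mul_pathWord_self R p.2.2

variable (R) in
theorem word_mul_ghost_of_ne (p q : AnyPath V) (h : p.range ≠ q.range) :
    WordNull R (p.word * q.ghost) :=
  .of_vertex_ne (pathWord_mul_vertex R _) (vertex_mul_ghostWord R _) h

variable (R) in
theorem word_mul_word (p q : AnyPath V) :
    WordNull R (p.word * q.word) ∨ ∃ p' : AnyPath V, p'.length = p.length + q.length ∧
      WordEq R (p.word * q.word) p'.word := by
  obtain ⟨a, b, p⟩ := p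
  obtain ⟨c, d, q⟩ := q
  by_cases h : b = c
  · subst h
    exact .inr ⟨⟨a, d, p.comp q⟩, Quiver.Path.length_comp _ _, (pathWord_comp R p q).symm⟩
  · exact .inl (.of_vertex_ne (pathWord_mul_vertex R _) (vertex_mul_pathWord R _) h)

variable (R) in
theorem ghost_mul_ghost (p q : AnyPath V) :
    WordNull R (p.ghost * q.ghost) ∨ ∃ p' : AnyPath V, p'.length = q.length + p.length ∧
      WordEq R (p.ghost * q.ghost) p'.ghost := by
  obtain ⟨a, b, p⟩ := p
  obtain ⟨c, d, q⟩ := q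
  by_cases h : a = d
  · subst h
    exact .inr ⟨⟨c, b, q.comp p⟩, Quiver.Path.length_comp _ _, (ghostWord_comp R q p).symm⟩
  · exact .inl (.of_vertex_ne (ghostWord_mul_vertex R _) (vertex_mul_ghostWord R _) h)

variable (R) in
-- Cut `q` after `p.length` edges: the initial piece either equals `p` and cancels, or annihilates
-- the product.
theorem ghost_mul_word_of_le (p q : AnyPath V) (h : p.length ≤ q.length) :
    WordNull R (p.ghost * q.word) ∨ ∃ q' : AnyPath V, q'.length + p.length = q.length ∧
      WordEq R (p.ghost * q.word) q'.word := by
  obtain ⟨c, d, q⟩ := q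
  obtain ⟨x, q₁, q₂, rfl, h₁⟩ := Quiver.Path.exists_eq_comp_of_le_length q h
  have h₂ := (pathWord_comp R q₁ q₂).mul_left p.ghost
  rw [← mul_assoc] at h₂
  obtain h₃ | rfl := ghost_mul_word R p ⟨c, x, q₁⟩ h₁.symm
  · exact .inl (h₂.null (h₃.mul_right _))
  · refine .inr ⟨⟨x, d, q₂⟩, ?_, ?_⟩
    · simp [AnyPath.length, Quiver.Path.length_comp, add_comm]
    · exact h₂.trans (((ghostWord_mul_pathWord_self R q₁).mul_right _).trans
        (vertex_mul_pathWord R q₂))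

variable (R) in
theorem ghost_mul_word_of_ge (p q : AnyPath V) (h : q.length ≤ p.length) :
    WordNull R (p.ghost * q.word) ∨ ∃ p' : AnyPath V, p'.length + q.length = p.length ∧
      WordEq R (p.ghost * q.word) p'.ghost := by
  obtain ⟨c, d, p⟩ := p
  obtain ⟨x, p₁, p₂, rfl, h₁⟩ := Quiver.Path.exists_eq_comp_of_le_length p h
  have h₂ := (ghostWord_comp R p₁ p₂).mul_right q.word
  rw [mul_assoc] at h₂
  obtain h₃ | rfl := ghost_mul_word R ⟨c, x, p₁⟩ q h₁
  · exact .inl (h₂.null (h₃.mul_left _))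
  · refine .inr ⟨⟨x, d, p₂⟩, ?_, ?_⟩
    · simp [AnyPath.length, Quiver.Path.length_comp, add_comm]
    · exact h₂.trans (((ghostWord_mul_pathWord_self R p₁).mul_left _).trans
        (ghostWord_mul_vertex R p₂))

variable (R) in
/-- The product `μ η* · μ' η'*` if `η` is at most as long as `μ'`. -/
theorem word_ghost_mul_word_ghost_of_le (m n m' n' : AnyPath V) (h : n.length ≤ m'.length) :
    WordNull R (m.word * n.ghost * (m'.word * n'.ghost)) ∨
      ∃ p : AnyPath V, p.length + n.length = m.length + m'.length ∧
        WordEq R (m.word * n.ghost * (m'.word * n'.ghost)) (p.word * n'.ghost) := by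
  rw [show m.word * n.ghost * (m'.word * n'.ghost) = m.word * (n.ghost * m'.word) * n'.ghost by
    simp only [mul_assoc]]
  obtain h₁ | ⟨q, hq, h₁⟩ := ghost_mul_word_of_le R n m' h
  · exact .inl ((h₁.mul_left _).mul_right _)
  obtain h₂ | ⟨p, hp, h₂⟩ := word_mul_word R m q
  · exact .inl ((((h₁.mul_left _).mul_right _)).null (h₂.mul_right _))
  · exact .inr ⟨p, by lia, ((h₁.mul_left _).mul_right _).trans (h₂.mul_right _)⟩

variable (R) in
/-- The product `μ η* · μ' η'*` if `η` is at least as long as `μ'`. -/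
theorem word_ghost_mul_word_ghost_of_ge (m n m' n' : AnyPath V) (h : m'.length ≤ n.length) :
    WordNull R (m.word * n.ghost * (m'.word * n'.ghost)) ∨
      ∃ p : AnyPath V, p.length + m'.length = n'.length + n.length ∧
        WordEq R (m.word * n.ghost * (m'.word * n'.ghost)) (m.word * p.ghost) := by
  rw [show m.word * n.ghost * (m'.word * n'.ghost) = m.word * (n.ghost * m'.word * n'.ghost) by
    simp only [mul_assoc]]
  obtain h₁ | ⟨q, hq, h₁⟩ := ghost_mul_word_of_ge R n m' h
  · exact .inl ((h₁.mul_right _).mul_left _)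
  obtain h₂ | ⟨p, hp, h₂⟩ := ghost_mul_ghost R q n'
  · exact .inl ((((h₁.mul_right _).mul_left _)).null (h₂.mul_left _))
  · exact .inr ⟨p, by lia, ((h₁.mul_right _).mul_left _).trans (h₂.mul_left _)⟩

/-! ### Spanning by the monomials `μη*` -/

variable (R) in
theorem exists_wordEq_of (g : LeavittGen V) :
    ∃ p q : AnyPath V, WordEq R (of g) (p.word * q.ghost) := by
  cases g with
  | vertex a =>
    exact ⟨⟨a, a, .nil⟩, ⟨a, a, .nil⟩, (vertex_mul_pathWord R (.nil : Quiver.Path a a)).symm⟩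
  | edge e =>
    refine ⟨⟨e.left, e.right, e.hom.toPath⟩, ⟨e.right, e.right, .nil⟩, ?_⟩
    refine Eq.trans ?_ (pathWord_mul_vertex R e.hom.toPath).symm
    exact (wordEq_of_rel fun r => .source_mul_edge r e : WordEq R _ _).symm
  | ghost e =>
    refine ⟨⟨e.right, e.right, .nil⟩, ⟨e.left, e.right, e.hom.toPath⟩, ?_⟩
    refine Eq.trans ?_ (vertex_mul_ghostWord R e.hom.toPath).symm
    exact (wordEq_of_rel fun r => .ghost_mul_source r e : WordEq R _ _).symm

variable (R) in
theorem wordNull_or_wordEq (m : FreeSemigroup (LeavittGen V)) :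
    WordNull R m ∨ ∃ p q : AnyPath V, p.range = q.range ∧ WordEq R m (p.word * q.ghost) := by
  -- Equality of ranges need not be carried through the induction: a monomial with different ranges
  -- is zero.
  suffices h : WordNull R m ∨ ∃ p q : AnyPath V, WordEq R m (p.word * q.ghost) by
    obtain h | ⟨p, q, h⟩ := h
    · exact .inl h
    by_cases hpq : p.range = q.range
    · exact .inr ⟨p, q, hpq, h⟩
    · exact .inl (h.null (word_mul_ghost_of_ne R p q hpq))
  induction m using FreeSemigroup.recOnMul with
  | ih1 g => exact .inr (exists_wordEq_of R g)
  | ih2 g m _ ih =>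
    obtain ⟨p, q, h₁⟩ := exists_wordEq_of R g
    obtain h₂ | ⟨p', q', h₂⟩ := ih
    · exact .inl (h₂.mul_left _)
    have h₃ : WordEq R (of g * m) _ := (h₁.mul_right m).trans (h₂.mul_left _)
    obtain h | h := le_total q.length p'.length
    · obtain h₄ | ⟨p₁, -, h₄⟩ := word_ghost_mul_word_ghost_of_le R p q p' q' h
      · exact .inl (h₃.null h₄)
      · exact .inr ⟨_, _, h₃.trans h₄⟩
    · obtain h₄ | ⟨p₁, -, h₄⟩ := word_ghost_mul_word_ghost_of_ge R p q p' q' h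
      · exact .inl (h₃.null h₄)
      · exact .inr ⟨_, _, h₃.trans h₄⟩

theorem monomial_eq_wordTerm (r : R) {a b c : V} (μ : Quiver.Path a c) (η : Quiver.Path b c) :
    monomial r μ η = wordTerm R (pathWord μ * ghostWord η) r := rfl

/-- The monomials `r μ η*` span the Leavitt path algebra. -/
theorem closure_monomial : AddSubgroup.closure {z : LeavittPathAlgebra R V |
    ∃ (r : R) (a b c : V) (μ : Quiver.Path a c) (η : Quiver.Path b c), z = monomial r μ η} = ⊤ := by
  rw [eq_top_iff, ← closure_wordTerm, AddSubgroup.closure_le]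
  rintro _ ⟨m, r, rfl⟩
  obtain h | ⟨⟨a, c, p⟩, ⟨b, d, q⟩, hpq, h⟩ := wordNull_or_wordEq R m
  · rw [show wordTerm R m = 0 from h]
    exact zero_mem _
  · rw [show wordTerm R m = _ from h]
    obtain rfl : c = d := hpq
    exact AddSubgroup.subset_closure ⟨r, a, b, c, p, q, rfl⟩

end LeavittPathAlgebra

/-! ### Von Neumann regular pairs of subgroups -/

/-- McCoy's lemma. Formally `x - xbx = x(1 - bx) = (1 - xb)x`, so `b + (1 - bx) y (1 - xb)` is an
inverse of `x`; it is written out in full because there is no unity. -/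
theorem eq_mul_mul_of_sub_eq {L : Type*} [NonUnitalRing L] {x b y : L}
    (h : x - x * b * x = (x - x * b * x) * y * (x - x * b * x)) :
    x = x * (b + y - y * x * b - b * x * y + b * x * y * x * b) * x := by
  have h' := sub_eq_iff_eq_add.1 h
  simp only [mul_add, mul_sub, add_mul, sub_mul, ← mul_assoc] at h' ⊢
  nth_rewrite 1 [h']
  abel

/-- Every element of `A` has a von Neumann inverse in `B`. -/
def IsRegularPair {L : Type*} [NonUnitalRing L] (A B : AddSubgroup L) : Prop :=
  ∀ x ∈ A, ∃ y ∈ B, x = x * y * x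

/-- If the elements of `A` can be reduced to a regular pair by subtracting `x b x`, then `A` is
regular. -/
theorem IsRegularPair.of_reduction {L : Type*} [NonUnitalRing L] {A B A' B' : AddSubgroup L}
    (h : IsRegularPair A' B') (hB : B' ≤ B)
    (hBAB : ∀ b ∈ B, ∀ a ∈ A, ∀ b' ∈ B, b * a * b' ∈ B)
    (hred : ∀ x ∈ A, ∃ b ∈ B, x - x * b * x ∈ A') : IsRegularPair A B := by
  intro x hx
  obtain ⟨b, hb, hxb⟩ := hred x hx
  obtain ⟨y, hy, hxy⟩ := h _ hxb
  replace hy := hB hy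
  refine ⟨_, ?_, eq_mul_mul_of_sub_eq hxy⟩
  refine add_mem (sub_mem (sub_mem (add_mem hb hy) (hBAB _ hy _ hx _ hb)) (hBAB _ hb _ hx _ hy)) ?_
  exact hBAB _ (hBAB _ hb _ hx _ hy) _ hx _ hb

theorem AddSubgroup.mul_mem_of_closure {L : Type*} [NonUnitalRing L] {s t : Set L}
    {C : AddSubgroup L} (h : ∀ x ∈ s, ∀ y ∈ t, x * y ∈ C) {x y : L}
    (hx : x ∈ AddSubgroup.closure s) (hy : y ∈ AddSubgroup.closure t) : x * y ∈ C := by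
  induction hx using AddSubgroup.closure_induction with
  | zero => simp
  | neg x _ hx => simpa using hx
  | add x z _ _ hx hz => rw [add_mul]; exact add_mem hx hz
  | mem x hx =>
    induction hy using AddSubgroup.closure_induction with
    | zero => simp
    | neg x _ hx => simpa using hx
    | add x z _ _ hx hz => rw [mul_add]; exact add_mem hx hz
    | mem y hy => exact h x hx y hy

namespace LeavittPathAlgebra

open FreeSemigroup LeavittGen

variable {R : Type u} [Ring R] {V : Type v} [Quiver.{w} V]

/-! ### Rectangular blocks of the Leavitt path algebra -/

/-- The sums of monomials `r p q*` with `p ∈ P` and `q ∈ Q`. -/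
noncomputable def block (R : Type u) [Ring R] (P Q : Set (AnyPath V)) :
    AddSubgroup (LeavittPathAlgebra R V) :=
  AddSubgroup.closure {z | ∃ r : R, ∃ p ∈ P, ∃ q ∈ Q, z = wordTerm R (p.word * q.ghost) r}

theorem block_mono {P P' Q Q' : Set (AnyPath V)} (hP : P ⊆ P') (hQ : Q ⊆ Q') :
    block R P Q ≤ block R P' Q' := by
  refine AddSubgroup.closure_mono ?_
  rintro _ ⟨r, p, hp, q, hq, rfl⟩
  exact ⟨r, p, hP hp, q, hQ hq, rfl⟩

theorem block_union_left (P P' Q : Set (AnyPath V)) :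
    block R (P ∪ P') Q = block R P Q ⊔ block R P' Q := by
  rw [block, block, block, ← AddSubgroup.closure_union]
  congr 1
  ext z
  constructor
  · rintro ⟨r, p, hp | hp, h⟩
    · exact .inl ⟨r, p, hp, h⟩
    · exact .inr ⟨r, p, hp, h⟩
  · rintro (⟨r, p, hp, h⟩ | ⟨r, p, hp, h⟩)
    · exact ⟨r, p, .inl hp, h⟩
    · exact ⟨r, p, .inr hp, h⟩

theorem block_union_right (P Q Q' : Set (AnyPath V)) :
    block R P (Q ∪ Q') = block R P Q ⊔ block R P Q' := by
  rw [block, block, block, ← AddSubgroup.closure_union]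
  congr 1
  ext z
  constructor
  · rintro ⟨r, p, hp, q, hq | hq, h⟩
    · exact .inl ⟨r, p, hp, q, hq, h⟩
    · exact .inr ⟨r, p, hp, q, hq, h⟩
  · rintro (⟨r, p, hp, q, hq, h⟩ | ⟨r, p, hp, q, hq, h⟩)
    · exact ⟨r, p, hp, q, .inl hq, h⟩
    · exact ⟨r, p, hp, q, .inr hq, h⟩

theorem eq_zero_of_mem_block_empty_left {Q : Set (AnyPath V)} {x : LeavittPathAlgebra R V}
    (hx : x ∈ block R ∅ Q) : x = 0 := by
  simpa [block] using hx

theorem eq_zero_of_mem_block_empty_right {P : Set (AnyPath V)} {x : LeavittPathAlgebra R V}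
    (hx : x ∈ block R P ∅) : x = 0 := by
  simpa [block] using hx

/-- The multiplication rule of matrix units, with paths of one fixed length as inner indices. The
product also vanishes for `n = m'` if `m` and `n` have different ranges, since then `m n* = 0`. -/
theorem wordTerm_mul_wordTerm_of_length_eq (r s : R) (m n m' n' : AnyPath V)
    (h : n.length = m'.length) :
    wordTerm R (m.word * n.ghost) r * wordTerm R (m'.word * n'.ghost) s = 0 ∨ n = m' ∧
    wordTerm R (m.word * n.ghost) r * wordTerm R (m'.word * n'.ghost) s =
      wordTerm R (m.word * n'.ghost) (r * s) := by
  have h₀ : m.word * n.ghost * (m'.word * n'.ghost) = m.word * (n.ghost * m'.word) * n'.ghost := by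
    simp only [mul_assoc]
  rw [wordTerm_mul_wordTerm, h₀]
  obtain h₁ | rfl := ghost_mul_word R n m' h
  · left
    rw [show wordTerm R _ = 0 from (h₁.mul_left _).mul_right _, AddMonoidHom.zero_apply]
  · have h₁ := ((ghost_mul_word_self R n).mul_left m.word).mul_right n'.ghost
    rw [show wordTerm R _ = _ from h₁]
    by_cases h₂ : m.range = n.range
    · refine .inr ⟨rfl, ?_⟩
      rw [← h₂, show wordTerm R _ = _ from (pathWord_mul_vertex R m.2.2).mul_right _]
    · left
      rw [show wordTerm R _ = _ from
        (WordNull.of_vertex_ne (pathWord_mul_vertex R m.2.2) _ h₂).mul_right _,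
        AddMonoidHom.zero_apply]
      exact wordEq_of_rel fun r => .vertex_mul_self r _

theorem mul_mem_block {P Q Q' P' : Set (AnyPath V)} {n : ℕ} (hQ : ∀ q ∈ Q, q.length = n)
    (hQ' : ∀ q ∈ Q', q.length = n) {x y : LeavittPathAlgebra R V} (hx : x ∈ block R P Q)
    (hy : y ∈ block R Q' P') : x * y ∈ block R P P' := by
  refine AddSubgroup.mul_mem_of_closure ?_ hx hy
  rintro _ ⟨r, p, hp, q, hq, rfl⟩ _ ⟨r', q', hq', p', hp', rfl⟩
  obtain h | ⟨-, h⟩ := wordTerm_mul_wordTerm_of_length_eq r r' p q q' p'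
    ((hQ q hq).trans (hQ' q' hq').symm)
  · rw [h]; exact zero_mem _
  · rw [h]; exact AddSubgroup.subset_closure ⟨_, p, hp, p', hp', rfl⟩

theorem mul_eq_zero_of_mem_block {P Q Q' P' : Set (AnyPath V)} {n : ℕ}
    (hQ : ∀ q ∈ Q, q.length = n) (hQ' : ∀ q ∈ Q', q.length = n) (hd : Disjoint Q Q')
    {x y : LeavittPathAlgebra R V} (hx : x ∈ block R P Q) (hy : y ∈ block R Q' P') :
    x * y = 0 := by
  refine AddSubgroup.mem_bot.1 (AddSubgroup.mul_mem_of_closure ?_ hx hy)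
  rintro _ ⟨r, p, hp, q, hq, rfl⟩ _ ⟨r', q', hq', p', hp', rfl⟩
  obtain h | ⟨h, -⟩ := wordTerm_mul_wordTerm_of_length_eq r r' p q q' p'
    ((hQ q hq).trans (hQ' q' hq').symm)
  · exact h
  · exact (Set.disjoint_left.1 hd hq (h ▸ hq')).elim

theorem mem_block_singleton {p q : AnyPath V} {x : LeavittPathAlgebra R V}
    (hx : x ∈ block R {p} {q}) : ∃ r : R, x = wordTerm R (p.word * q.ghost) r := by
  induction hx using AddSubgroup.closure_induction with
  | zero => exact ⟨0, (map_zero _).symm⟩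
  | neg x _ hx =>
    obtain ⟨r, rfl⟩ := hx
    exact ⟨-r, (map_neg _ _).symm⟩
  | add x y _ _ hx hy =>
    obtain ⟨r, rfl⟩ := hx
    obtain ⟨s, rfl⟩ := hy
    exact ⟨r + s, (map_add _ _ _).symm⟩
  | mem x hx =>
    obtain ⟨r, _, rfl, _, rfl, rfl⟩ := hx
    exact ⟨r, rfl⟩

theorem isRegularPair_block_singleton (hR : IsVonNeumannRegular R) (p q : AnyPath V) :
    IsRegularPair (block R {p} {q}) (block R {q} {p}) := by
  intro x hx
  obtain ⟨r, rfl⟩ := mem_block_singleton hx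
  obtain ⟨s, hs⟩ := hR r
  refine ⟨_, AddSubgroup.subset_closure ⟨s, q, rfl, p, rfl, rfl⟩, ?_⟩
  by_cases h : p.range = q.range
  · have h₁ : WordEq R (p.word * q.ghost * (q.word * p.ghost) * (p.word * q.ghost))
        (p.word * q.ghost) := by
      have e : p.word * q.ghost * (q.word * p.ghost) * (p.word * q.ghost) =
        p.word * (q.ghost * q.word) * (p.ghost * p.word) * q.ghost := by simp only [mul_assoc]
      rw [e]
      have h₂ := (((ghost_mul_word_self R q).mul_left p.word).mul_right
        (p.ghost * p.word)).mul_right q.ghost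
      rw [← h] at h₂
      have h₃ := (pathWord_mul_vertex R p.2.2).mul_right (p.ghost * p.word) |>.mul_right q.ghost
      have h₄ := ((ghost_mul_word_self R p).mul_left p.word).mul_right q.ghost
      exact h₂.trans (h₃.trans (h₄.trans ((pathWord_mul_vertex R p.2.2).mul_right _)))
    rw [wordTerm_mul_wordTerm, wordTerm_mul_wordTerm, show wordTerm R _ = _ from h₁, ← hs]
  · rw [show wordTerm R _ = 0 from word_mul_ghost_of_ne R p q h]
    simp

/-- A single row, by induction on its entries: an inverse of the entries in `Q` serves as `b` in
McCoy's lemma and reduces the row to the one entry at `q`. -/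
theorem isRegularPair_block_singleton_left (hR : IsVonNeumannRegular R) (p : AnyPath V) {n : ℕ}
    {Q : Set (AnyPath V)} (hQ : Q.Finite) (hn : ∀ q ∈ Q, q.length = n) :
    IsRegularPair (block R {p} Q) (block R Q {p}) := by
  induction Q, hQ using Set.Finite.induction_on with
  | empty =>
    intro x hx
    exact ⟨0, zero_mem _, by rw [eq_zero_of_mem_block_empty_right hx, mul_zero]⟩
  | @insert q Q hq _ ih =>
    have hnQ : ∀ q ∈ Q, q.length = n := fun q' hq' => hn _ (.inr hq')
    have hp : ∀ q ∈ ({p} : Set (AnyPath V)), q.length = p.length := fun q hq => by rw [hq]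
    refine (isRegularPair_block_singleton hR p q).of_reduction
      (block_mono (by simp) le_rfl) (fun b hb a ha b' hb' => ?_) fun x hx => ?_
    · exact mul_mem_block hn hn (mul_mem_block hp hp hb ha) hb'
    · rw [Set.insert_eq, block_union_right] at hx
      obtain ⟨a, ha, c, hc, rfl⟩ := AddSubgroup.mem_sup.1 hx
      obtain ⟨b, hb, hcb⟩ := ih hnQ c hc
      refine ⟨b, block_mono (Set.subset_insert _ _) le_rfl hb, ?_⟩
      have hab : a * b = 0 := mul_eq_zero_of_mem_block (n := n)
        (by rintro _ rfl; exact hn _ (.inl rfl)) hnQ (Set.disjoint_singleton_left.2 hq) ha hb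
      -- `c * b` lies in the `(p, p)` block, so what remains is still supported at the column `q`.
      have e : a + c - (a + c) * b * (a + c) = a - c * b * a := by
        rw [add_mul, hab, zero_add, mul_add, ← hcb]; abel
      rw [e]
      exact sub_mem ha (mul_mem_block hp hp (mul_mem_block hnQ hnQ hc hb) ha)

/-- The same elimination by rows: here `b * a = 0`, and the remainder `a - a * b * c` lies in the
single row `p`. -/
theorem isRegularPair_block (hR : IsVonNeumannRegular R) {m n : ℕ} {P Q : Set (AnyPath V)}
    (hP : P.Finite) (hm : ∀ p ∈ P, p.length = m) (hQ : Q.Finite) (hn : ∀ q ∈ Q, q.length = n) :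
    IsRegularPair (block R P Q) (block R Q P) := by
  induction P, hP using Set.Finite.induction_on with
  | empty =>
    intro x hx
    exact ⟨0, zero_mem _, by rw [eq_zero_of_mem_block_empty_left hx, mul_zero]⟩
  | @insert p P hp _ ih =>
    have hmP : ∀ p ∈ P, p.length = m := fun q' hq' => hm _ (.inr hq')
    refine (isRegularPair_block_singleton_left hR p hQ hn).of_reduction
      (block_mono le_rfl (by simp)) (fun b hb a ha b' hb' => ?_) fun x hx => ?_
    · exact mul_mem_block hn hn (mul_mem_block hm hm hb ha) hb'
    · rw [Set.insert_eq, block_union_left] at hx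
      obtain ⟨a, ha, c, hc, rfl⟩ := AddSubgroup.mem_sup.1 hx
      obtain ⟨b, hb, hcb⟩ := ih hmP c hc
      refine ⟨b, block_mono le_rfl (Set.subset_insert _ _) hb, ?_⟩
      have hba : b * a = 0 := mul_eq_zero_of_mem_block (n := m) hmP
        (by rintro _ rfl; exact hm _ (.inl rfl)) (Set.disjoint_singleton_right.2 hp) hb ha
      have e : a + c - (a + c) * b * (a + c) = a - a * b * c := by
        rw [mul_add, mul_assoc _ b a, hba, mul_zero, zero_add, add_mul, add_mul, ← hcb]; abel
      rw [e]
      exact sub_mem ha (mul_mem_block hmP hmP (mul_mem_block hn hn ha hb) hc)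

/-! ### Layers and filtration by path length -/

/-- The sums of monomials `r p q*` with `p` of length `m` and `q` of length `n`. -/
noncomputable def lengthBlock (R : Type u) [Ring R] (V : Type v) [Quiver.{w} V] (m n : ℕ) :
    AddSubgroup (LeavittPathAlgebra R V) :=
  block R {p | p.length = m} {q | q.length = n}

theorem exists_finite_of_mem_block {P Q : Set (AnyPath V)} {x : LeavittPathAlgebra R V}
    (hx : x ∈ block R P Q) :
    ∃ P' ⊆ P, ∃ Q' ⊆ Q, P'.Finite ∧ Q'.Finite ∧ x ∈ block R P' Q' := by
  induction hx using AddSubgroup.closure_induction with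
  | zero => exact ⟨∅, by simp, ∅, by simp, by simp, by simp, zero_mem _⟩
  | neg x _ hx =>
    obtain ⟨P', hP, Q', hQ, hP', hQ', h⟩ := hx
    exact ⟨P', hP, Q', hQ, hP', hQ', neg_mem h⟩
  | add x y _ _ hx hy =>
    obtain ⟨P₁, hP₁, Q₁, hQ₁, hP₁', hQ₁', h₁⟩ := hx
    obtain ⟨P₂, hP₂, Q₂, hQ₂, hP₂', hQ₂', h₂⟩ := hy
    exact ⟨P₁ ∪ P₂, Set.union_subset hP₁ hP₂, Q₁ ∪ Q₂, Set.union_subset hQ₁ hQ₂, hP₁'.union hP₂',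
      hQ₁'.union hQ₂', add_mem (block_mono (by simp) (by simp) h₁)
        (block_mono (by simp) (by simp) h₂)⟩
  | mem x hx =>
    obtain ⟨r, p, hp, q, hq, rfl⟩ := hx
    exact ⟨{p}, by simpa, {q}, by simpa, by simp, by simp,
      AddSubgroup.subset_closure ⟨r, p, rfl, q, rfl, rfl⟩⟩

theorem isRegularPair_lengthBlock (hR : IsVonNeumannRegular R) (m n : ℕ) :
    IsRegularPair (lengthBlock R V m n) (lengthBlock R V n m) := by
  intro x hx
  obtain ⟨P, hP, Q, hQ, hP', hQ', h⟩ := exists_finite_of_mem_block hx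
  obtain ⟨y, hy, hxy⟩ := isRegularPair_block hR hP' hP hQ' hQ x h
  exact ⟨y, block_mono hQ hP hy, hxy⟩

/-- The sums of monomials `r p q*` where the lengths of `p` and `q` are `m + t` and `n + t` for
some `t ≤ k`. -/
noncomputable def lengthFiltration (R : Type u) [Ring R] (V : Type v) [Quiver.{w} V] (k m n : ℕ) :
    AddSubgroup (LeavittPathAlgebra R V) :=
  AddSubgroup.closure {z | ∃ (r : R) (p q : AnyPath V) (t : ℕ), t ≤ k ∧ p.length = m + t ∧
    q.length = n + t ∧ z = wordTerm R (p.word * q.ghost) r}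

theorem lengthFiltration_mono {k l : ℕ} (h : k ≤ l) (m n : ℕ) :
    lengthFiltration R V k m n ≤ lengthFiltration R V l m n := by
  refine AddSubgroup.closure_mono ?_
  rintro _ ⟨r, p, q, t, ht, hp, hq, rfl⟩
  exact ⟨r, p, q, t, ht.trans h, hp, hq, rfl⟩

theorem lengthBlock_le_lengthFiltration (k m n : ℕ) :
    lengthBlock R V (m + k) (n + k) ≤ lengthFiltration R V k m n := by
  refine AddSubgroup.closure_mono ?_
  rintro _ ⟨r, p, hp, q, hq, rfl⟩
  exact ⟨r, p, q, k, le_rfl, hp, hq, rfl⟩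

theorem lengthFiltration_zero_le (m n : ℕ) :
    lengthFiltration R V 0 m n ≤ lengthBlock R V m n := by
  refine AddSubgroup.closure_mono ?_
  rintro _ ⟨r, p, q, t, ht, hp, hq, rfl⟩
  obtain rfl := Nat.le_zero.1 ht
  exact ⟨r, p, hp, q, hq, rfl⟩

theorem lengthFiltration_succ_le (k m n : ℕ) : lengthFiltration R V (k + 1) m n ≤
    lengthFiltration R V k m n ⊔ lengthBlock R V (m + (k + 1)) (n + (k + 1)) := by
  refine (AddSubgroup.closure_le _).2 ?_
  rintro _ ⟨r, p, q, t, ht, hp, hq, rfl⟩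
  obtain ht | rfl := Nat.lt_or_eq_of_le ht
  · exact AddSubgroup.mem_sup_left
      (AddSubgroup.subset_closure ⟨r, p, q, t, Nat.le_of_lt_succ ht, hp, hq, rfl⟩)
  · exact AddSubgroup.mem_sup_right (AddSubgroup.subset_closure ⟨r, p, hp, q, hq, rfl⟩)

theorem wordTerm_mul_mem_of_le {C : AddSubgroup (LeavittPathAlgebra R V)} (r s : R)
    (m n m' n' : AnyPath V) (h : n.length ≤ m'.length)
    (hC : ∀ p : AnyPath V, p.length + n.length = m.length + m'.length →
      wordTerm R (p.word * n'.ghost) (r * s) ∈ C) :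
    wordTerm R (m.word * n.ghost) r * wordTerm R (m'.word * n'.ghost) s ∈ C := by
  rw [wordTerm_mul_wordTerm]
  obtain h₁ | ⟨p, hp, h₁⟩ := word_ghost_mul_word_ghost_of_le R m n m' n' h
  · rw [show wordTerm R _ = 0 from h₁]; exact zero_mem _
  · rw [show wordTerm R _ = _ from h₁]; exact hC p hp

theorem wordTerm_mul_mem_of_ge {C : AddSubgroup (LeavittPathAlgebra R V)} (r s : R)
    (m n m' n' : AnyPath V) (h : m'.length ≤ n.length)
    (hC : ∀ p : AnyPath V, p.length + m'.length = n'.length + n.length →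
      wordTerm R (m.word * p.ghost) (r * s) ∈ C) :
    wordTerm R (m.word * n.ghost) r * wordTerm R (m'.word * n'.ghost) s ∈ C := by
  rw [wordTerm_mul_wordTerm]
  obtain h₁ | ⟨p, hp, h₁⟩ := word_ghost_mul_word_ghost_of_ge R m n m' n' h
  · rw [show wordTerm R _ = 0 from h₁]; exact zero_mem _
  · rw [show wordTerm R _ = _ from h₁]; exact hC p hp

/-- With `t ≤ k`, the ghost path of length `m + k` is at least as long as the path of length `m + t`
that it meets. Cancellation leaves the left path untouched, and the new ghost path has length `(n +
t) + (m + k) - (m + t) = n + k`. -/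
theorem mul_mem_lengthBlock_of_left {k l m n : ℕ} {x y : LeavittPathAlgebra R V}
    (hx : x ∈ lengthBlock R V l (m + k)) (hy : y ∈ lengthFiltration R V k m n) :
    x * y ∈ lengthBlock R V l (n + k) := by
  refine AddSubgroup.mul_mem_of_closure ?_ hx hy
  rintro _ ⟨r, p, hp, q, hq, rfl⟩ _ ⟨s, p', q', t, ht, hp', hq', rfl⟩
  rw [Set.mem_ofPred] at hp hq
  refine wordTerm_mul_mem_of_ge r s p q p' q' (by lia) fun p'' h => ?_
  exact AddSubgroup.subset_closure ⟨_, p, hp, p'', by rw [Set.mem_ofPred]; lia, rfl⟩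

theorem mul_mem_lengthBlock_of_right {k l m n : ℕ} {x y : LeavittPathAlgebra R V}
    (hx : x ∈ lengthFiltration R V k m n) (hy : y ∈ lengthBlock R V (n + k) l) :
    x * y ∈ lengthBlock R V (m + k) l := by
  refine AddSubgroup.mul_mem_of_closure ?_ hx hy
  rintro _ ⟨s, p', q', t, ht, hp', hq', rfl⟩ _ ⟨r, p, hp, q, hq, rfl⟩
  rw [Set.mem_ofPred] at hp hq
  refine wordTerm_mul_mem_of_le s r p' q' p q (by lia) fun p'' h => ?_
  exact AddSubgroup.subset_closure ⟨_, p'', by rw [Set.mem_ofPred]; lia, q, hq, rfl⟩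

theorem mul_mem_lengthFiltration {k l m n : ℕ} {x y : LeavittPathAlgebra R V}
    (hx : x ∈ lengthFiltration R V k l m) (hy : y ∈ lengthFiltration R V k m n) :
    x * y ∈ lengthFiltration R V k l n := by
  refine AddSubgroup.mul_mem_of_closure ?_ hx hy
  rintro _ ⟨r, p, q, t, ht, hp, hq, rfl⟩ _ ⟨s, p', q', t', ht', hp', hq', rfl⟩
  obtain h | h := le_total t t'
  · refine wordTerm_mul_mem_of_le r s p q p' q' (by lia) fun p'' h => ?_
    exact AddSubgroup.subset_closure ⟨_, p'', q', t', ht', by lia, hq', rfl⟩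
  · refine wordTerm_mul_mem_of_ge r s p q p' q' (by lia) fun p'' h => ?_
    exact AddSubgroup.subset_closure ⟨_, p, p'', t, ht, hp, by lia, rfl⟩

/-- The top layer plays the role of an ideal. An inverse of the lower part `a` reduces `a + j` to an
element of the top layer, which is regular as a block; no uniqueness of the splitting is used. -/
theorem isRegularPair_lengthFiltration (hR : IsVonNeumannRegular R) (k m n : ℕ) :
    IsRegularPair (lengthFiltration R V k m n) (lengthFiltration R V k n m) := by
  induction k with
  | zero =>
    intro x hx
    obtain ⟨y, hy, h⟩ := isRegularPair_lengthBlock hR m n x (lengthFiltration_zero_le m n hx)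
    exact ⟨y, lengthBlock_le_lengthFiltration 0 n m hy, h⟩
  | succ k ih =>
    refine (isRegularPair_lengthBlock hR (m + (k + 1)) (n + (k + 1))).of_reduction
      (lengthBlock_le_lengthFiltration _ _ _) (fun b hb a ha b' hb' =>
        mul_mem_lengthFiltration (mul_mem_lengthFiltration hb ha) hb') fun x hx => ?_
    obtain ⟨a, ha, j, hj, rfl⟩ := AddSubgroup.mem_sup.1 (lengthFiltration_succ_le k m n hx)
    obtain ⟨b, hb, hab⟩ := ih a ha
    replace ha := lengthFiltration_mono k.le_succ _ _ ha
    replace hb := lengthFiltration_mono k.le_succ _ _ hb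
    refine ⟨b, hb, ?_⟩
    have hjb := mul_mem_lengthBlock_of_left hj hb
    -- Since `a = a * b * a`, every surviving term contains a factor `j`.
    have e : a + j - (a + j) * b * (a + j) = j - j * b * a - a * (b * j) - j * b * j := by
      rw [add_mul, mul_add, add_mul, add_mul, ← hab, mul_assoc a b j]; abel
    rw [e]
    refine sub_mem (sub_mem (sub_mem hj (mul_mem_lengthBlock_of_left hjb ha)) ?_) ?_
    · exact mul_mem_lengthBlock_of_right ha (mul_mem_lengthBlock_of_right hb hj)
    · rw [mul_assoc]
      exact mul_mem_block (fun q hq => hq) (fun q hq => hq) hj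
        (mul_mem_lengthBlock_of_right hb hj)

end LeavittPathAlgebra

/-! ### The grading -/

namespace WeightMap

open LeavittPathAlgebra FreeSemigroup LeavittGen

variable {R : Type u} [Ring R] {V : Type v} [Quiver.{w} V]

section

variable {G : Type x} [AddGroup G] {I : Type y} (ω : WeightMap G I V)

/-- The weight of a generator. -/
def gen : LeavittGen V → BrandtSemigroup G I
  | .vertex a => ω.vertex a
  | .edge e => ω.edge e
  | .ghost e => ω.ghost e

/-- The weight of a word. -/
noncomputable def word : FreeSemigroup (LeavittGen V) →ₙ* BrandtSemigroup G I :=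
  FreeSemigroup.lift ω.gen

theorem word_of (g : LeavittGen V) : ω.word (of g) = ω.gen g := FreeSemigroup.lift_of ω.gen g

theorem word_pathWord {a b : V} (p : Quiver.Path a b) : ω.word (pathWord p) = ω.path p := by
  induction p with
  | nil => exact ω.word_of _
  | cons p e ih => rw [pathWord, map_mul, ih, path, word_of]; rfl

theorem word_ghostWord {a b : V} (p : Quiver.Path a b) :
    ω.word (ghostWord p) = ω.ghostPath p := by
  induction p with
  | nil => exact ω.word_of _
  | cons p e ih => rw [ghostWord, map_mul, ih, ghostPath, word_of]; rfl

theorem exists_vertex_eq (a : V) : ∃ i : I, ω.vertex a = .triple i 0 i := by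
  have h := ω.isIdempotentElem_vertex a
  have h₀ := ω.vertex_ne_zero a
  rw [IsIdempotentElem] at h
  cases hv : ω.vertex a with
  | zero => exact (h₀ hv).elim
  | triple i g j =>
    rw [hv, BrandtSemigroup.triple_mul_triple] at h
    split_ifs at h with hij
    · injection h with _ hg _
      exact ⟨i, by rw [hij, left_eq_add.1 hg.symm]⟩

theorem exists_edge_eq (e : Quiver.Total V) : ∃ (i j : I) (g : G), ω.vertex e.left = .triple i 0 i ∧
    ω.edge e = .triple i g j ∧ ω.vertex e.right = .triple j 0 j := by
  obtain ⟨i, hi⟩ := ω.exists_vertex_eq e.left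
  obtain ⟨j, hj⟩ := ω.exists_vertex_eq e.right
  have h₁ := ω.source_mul_edge e
  have h₂ := ω.edge_mul_range e
  have h₀ := ω.edge_ne_zero e
  cases he : ω.edge e with
  | zero => exact (h₀ he).elim
  | triple k g l =>
    rw [hi, he, BrandtSemigroup.triple_mul_triple] at h₁
    rw [hj, he, BrandtSemigroup.triple_mul_triple] at h₂
    split_ifs at h₁ with hik
    · split_ifs at h₂ with hjl
      · subst hik hjl
        exact ⟨_, _, g, hi, rfl, hj⟩

theorem gen_ghost_mul_edge (e : Quiver.Total V) : ω.ghost e * ω.edge e = ω.vertex e.right := by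
  obtain ⟨i, j, g, -, h, hr⟩ := ω.exists_edge_eq e
  rw [ω.ghost_eq, h, hr, BrandtSemigroup.inv_triple, BrandtSemigroup.triple_mul_triple, if_pos rfl,
    neg_add_cancel]

theorem gen_edge_mul_ghost (e : Quiver.Total V) : ω.edge e * ω.ghost e = ω.vertex e.left := by
  obtain ⟨i, j, g, hl, h, -⟩ := ω.exists_edge_eq e
  rw [ω.ghost_eq, h, hl, BrandtSemigroup.inv_triple, BrandtSemigroup.triple_mul_triple, if_pos rfl,
    add_neg_cancel]

theorem gen_range_mul_ghost (e : Quiver.Total V) : ω.vertex e.right * ω.ghost e = ω.ghost e := by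
  obtain ⟨i, j, g, -, h, hr⟩ := ω.exists_edge_eq e
  rw [ω.ghost_eq, h, hr, BrandtSemigroup.inv_triple, BrandtSemigroup.triple_mul_triple, if_pos rfl,
    zero_add]

theorem gen_ghost_mul_source (e : Quiver.Total V) : ω.ghost e * ω.vertex e.left = ω.ghost e := by
  obtain ⟨i, j, g, hl, h, -⟩ := ω.exists_edge_eq e
  rw [ω.ghost_eq, h, hl, BrandtSemigroup.inv_triple, BrandtSemigroup.triple_mul_triple, if_pos rfl,
    add_zero]

/-- The path and its ghost have mutually inverse nonzero weights. -/
theorem exists_path_eq {a b : V} (p : Quiver.Path a b) : ∃ (i j : I) (g : G),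
    ω.vertex b = .triple j 0 j ∧ ω.path p = .triple i g j ∧ ω.ghostPath p = .triple j (-g) i := by
  induction p with
  | nil =>
    obtain ⟨i, hi⟩ := ω.exists_vertex_eq a
    exact ⟨i, i, 0, hi, hi, by rw [neg_zero]; exact hi⟩
  | cons p e ih =>
    obtain ⟨i, j, g, hj, hp, hg⟩ := ih
    obtain ⟨j', l, k, hj', he, hl⟩ := ω.exists_edge_eq ⟨_, _, e⟩
    injection hj.symm.trans hj' with h _ _
    subst h
    refine ⟨i, l, g + k, hl, ?_, ?_⟩
    · rw [path, hp, he, BrandtSemigroup.triple_mul_triple, if_pos rfl]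
    · rw [ghostPath, hg, ω.ghost_eq, he, BrandtSemigroup.inv_triple,
        BrandtSemigroup.triple_mul_triple, if_pos rfl, neg_add_rev]

/-- The weight of the common range fixes the index at which the two weights meet. Hence no monomial
is lost to the degree `0`, whose component is trivial. -/
theorem path_mul_ghostPath_ne_zero {a b c : V} (μ : Quiver.Path a c) (η : Quiver.Path b c) :
    ω.path μ * ω.ghostPath η ≠ 0 := by
  obtain ⟨i, j, g, hj, hμ, -⟩ := ω.exists_path_eq μ
  obtain ⟨i', j', g', hj', -, hη⟩ := ω.exists_path_eq η
  injection hj.symm.trans hj' with h _ _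
  subst h
  rw [hμ, hη, BrandtSemigroup.triple_mul_triple, if_pos rfl]
  exact BrandtSemigroup.triple_ne_zero _ _ _

/-! ### Decomposition by weights -/

variable (R) in
/-- The decomposition of an element of the free ring by the weights of its words, with the parts
taken modulo the relations of the Leavitt path algebra. -/
noncomputable def freeDecompose :
    LeavittFree R V →+ (BrandtSemigroup G I →₀ LeavittPathAlgebra R V) :=
  (Finsupp.liftAddHom fun m => (Finsupp.singleAddHom (ω.word m)).comp (wordTerm R m)).comp
    MonoidAlgebra.coeffAddEquiv.toAddMonoidHom

theorem freeDecompose_single (m : FreeSemigroup (LeavittGen V)) (r : R) :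
    ω.freeDecompose R (MonoidAlgebra.single m r) = Finsupp.single (ω.word m) (wordTerm R m r) :=
  Finsupp.liftAddHom_apply_single _ _ _

/-- Multiplication by one word acts on decompositions alone: `F` moves the part of degree `s` to
degree `s * ω.word m` and multiplies it by the class of the word. -/
theorem freeDecompose_mul_right {x y : LeavittFree R V}
    (h : ω.freeDecompose R x = ω.freeDecompose R y) (z : LeavittFree R V) :
    ω.freeDecompose R (x * z) = ω.freeDecompose R (y * z) := by
  induction z using MonoidAlgebra.induction_linear with
  | zero => simp
  | add z z' hz hz' => rw [mul_add, mul_add, map_add, map_add, hz, hz']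
  | single m r =>
    let F : (BrandtSemigroup G I →₀ LeavittPathAlgebra R V) →+
        (BrandtSemigroup G I →₀ LeavittPathAlgebra R V) := Finsupp.liftAddHom fun s =>
      (Finsupp.singleAddHom (s * ω.word m)).comp (AddMonoidHom.mulRight (wordTerm R m r))
    have hF : ∀ x : LeavittFree R V,
        ω.freeDecompose R (x * MonoidAlgebra.single m r) = F (ω.freeDecompose R x) := by
      intro x
      induction x using MonoidAlgebra.induction_linear with
      | zero => simp
      | add x y hx hy => rw [add_mul, map_add, map_add, map_add, hx, hy]
      | single n s =>
        rw [MonoidAlgebra.single_mul_single, freeDecompose_single, freeDecompose_single,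
          Finsupp.liftAddHom_apply_single, map_mul, ← wordTerm_mul_wordTerm]
        rfl
    rw [hF, hF, h]

theorem freeDecompose_mul_left {x y : LeavittFree R V}
    (h : ω.freeDecompose R x = ω.freeDecompose R y) (z : LeavittFree R V) :
    ω.freeDecompose R (z * x) = ω.freeDecompose R (z * y) := by
  induction z using MonoidAlgebra.induction_linear with
  | zero => simp
  | add z z' hz hz' => rw [add_mul, add_mul, map_add, map_add, hz, hz']
  | single m r =>
    let F : (BrandtSemigroup G I →₀ LeavittPathAlgebra R V) →+
        (BrandtSemigroup G I →₀ LeavittPathAlgebra R V) := Finsupp.liftAddHom fun s =>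
      (Finsupp.singleAddHom (ω.word m * s)).comp (AddMonoidHom.mulLeft (wordTerm R m r))
    have hF : ∀ x : LeavittFree R V,
        ω.freeDecompose R (MonoidAlgebra.single m r * x) = F (ω.freeDecompose R x) := by
      intro x
      induction x using MonoidAlgebra.induction_linear with
      | zero => simp
      | add x y hx hy => rw [mul_add, map_add, map_add, map_add, hx, hy]
      | single n s =>
        rw [MonoidAlgebra.single_mul_single, freeDecompose_single, freeDecompose_single,
          Finsupp.liftAddHom_apply_single, map_mul, ← wordTerm_mul_wordTerm]
        rfl
    rw [hF, hF, h]

variable (R) in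
/-- The congruence of having the same decomposition. -/
noncomputable def decomposeCon : RingCon (LeavittFree R V) where
  r x y := ω.freeDecompose R x = ω.freeDecompose R y
  iseqv := ⟨fun _ => rfl, Eq.symm, Eq.trans⟩
  add' h h' := by rw [map_add, map_add, h, h']
  mul' h h' := (ω.freeDecompose_mul_right h _).trans (ω.freeDecompose_mul_left h' _)

variable (R) in
-- Both sides of a relation sit in one degree, where their equality is the relation itself, because
-- the parts are taken in `L`. For the same reason a word that is zero in `L` causes no trouble,
-- whatever its weight.
theorem leavittCon_le_decomposeCon : leavittCon R V ≤ ω.decomposeCon R := by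
  have h₁ : ∀ (r : R) (m n : FreeSemigroup (LeavittGen V)), ω.word m = ω.word n →
      leavittCon R V (.single m r) (.single n r) →
      ω.decomposeCon R (.single m r) (.single n r) := fun r m n hw h => by
    change ω.freeDecompose R _ = ω.freeDecompose R _
    rw [freeDecompose_single, freeDecompose_single, hw]
    exact congrArg _ ((RingCon.eq _).2 h)
  have h₀ : ∀ (r : R) (m : FreeSemigroup (LeavittGen V)),
      leavittCon R V (.single m r) 0 → ω.decomposeCon R (.single m r) 0 := fun r m h => by
    change ω.freeDecompose R _ = ω.freeDecompose R _
    rw [freeDecompose_single, map_zero, show wordTerm R m r = 0 from (RingCon.eq _).2 h,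
      Finsupp.single_zero]
  refine RingCon.ringConGen_le.2 fun x y h => ?_
  have h' : leavittCon R V x y := RingConGen.Rel.of _ _ h
  cases h with
  | vertex_mul_self r a =>
    exact h₁ _ _ _ (by simp only [map_mul, word_of]; exact ω.isIdempotentElem_vertex a) h'
  | vertex_mul_vertex r a b h => exact h₀ _ _ h'
  | source_mul_edge r e => exact h₁ _ _ _ (by simp only [map_mul, word_of]; exact ω.source_mul_edge e) h'
  | edge_mul_range r e => exact h₁ _ _ _ (by simp only [map_mul, word_of]; exact ω.edge_mul_range e) h'
  | range_mul_ghost r e => exact h₁ _ _ _ (by simp only [map_mul, word_of]; exact ω.gen_range_mul_ghost e) h'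
  | ghost_mul_source r e => exact h₁ _ _ _ (by simp only [map_mul, word_of]; exact ω.gen_ghost_mul_source e) h'
  | ghost_mul_edge_self r e => exact h₁ _ _ _ (by simp only [map_mul, word_of]; exact ω.gen_ghost_mul_edge e) h'
  | ghost_mul_edge r e f h => exact h₀ _ _ h'
  | @sum_edge_mul_ghost r a h _ =>
    change ω.freeDecompose R _ = ω.freeDecompose R _
    rw [map_sum, freeDecompose_single, word_of]
    have hs : ∀ e : EmittedEdge a,
        ω.freeDecompose R (LeavittFree.term r (of (LeavittGen.edge e.1) * of (LeavittGen.ghost e.1))) =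
          Finsupp.singleAddHom (ω.vertex a) (wordTerm R (of (LeavittGen.edge e.1) * of (LeavittGen.ghost e.1)) r) := by
      rintro ⟨e, rfl⟩
      rw [freeDecompose_single, map_mul, word_of, word_of]
      exact congrArg (Finsupp.single · _) (ω.gen_edge_mul_ghost e)
    rw [Finset.sum_congr rfl fun e _ => hs e, ← map_sum]
    refine congrArg (Finsupp.single _) (Eq.trans ?_ ((RingCon.eq _).2 h'))
    exact (map_sum (⟨⟨fun x : LeavittFree R V => (x : LeavittPathAlgebra R V), rfl⟩,
      fun _ _ => rfl⟩ : LeavittFree R V →+ LeavittPathAlgebra R V) _ _).symm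

variable (R) in
/-- The decomposition of an element of the Leavitt path algebra by weights. -/
noncomputable def decompose :
    LeavittPathAlgebra R V →+ (BrandtSemigroup G I →₀ LeavittPathAlgebra R V) where
  toFun := Quotient.lift (ω.freeDecompose R) fun _ _ h => ω.leavittCon_le_decomposeCon R h
  map_zero' := map_zero (ω.freeDecompose R)
  map_add' x y := by
    induction x using Quotient.inductionOn
    induction y using Quotient.inductionOn
    exact map_add (ω.freeDecompose R) _ _

theorem decompose_wordTerm (m : FreeSemigroup (LeavittGen V)) (r : R) :
    ω.decompose R (wordTerm R m r) = Finsupp.single (ω.word m) (wordTerm R m r) :=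
  ω.freeDecompose_single m r

theorem component_zero : ω.component R 0 = ⊥ := by
  rw [component, eq_bot_iff, AddSubgroup.closure_le]
  rintro _ ⟨h, -⟩
  exact (h rfl).elim

theorem decompose_of_mem {s : BrandtSemigroup G I} {x : LeavittPathAlgebra R V}
    (hx : x ∈ ω.component R s) : ω.decompose R x = Finsupp.single s x := by
  induction hx using AddSubgroup.closure_induction with
  | zero => simp
  | neg x _ hx => rw [map_neg, hx, Finsupp.single_neg]
  | add x y _ _ hx hy => rw [map_add, hx, hy, Finsupp.single_add]
  | mem x hx =>
    obtain ⟨-, r, a, b, c, μ, η, rfl, rfl⟩ := hx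
    rw [monomial_eq_wordTerm, decompose_wordTerm, map_mul, word_pathWord, word_ghostWord]

open Classical in
-- Summation followed by decomposition returns the summands, which yields directness.
theorem decompose_coeAddMonoidHom (d : DirectSum _ fun s => ω.component R s)
    (s : BrandtSemigroup G I) :
    ω.decompose R (DirectSum.coeAddMonoidHom (ω.component R) d) s = d s := by
  induction d using DirectSum.induction_on with
  | zero => simp
  | add d d' h h' => simp [h, h']
  | of t z =>
    rw [DirectSum.coeAddMonoidHom_of, ω.decompose_of_mem z.2, DirectSum.coe_of_apply,
      Finsupp.single_apply]
    split_ifs <;> rfl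

open Classical in
theorem isInternal_component : DirectSum.IsInternal (ω.component R) := by
  constructor
  · intro d d' h
    refine DFinsupp.ext fun s => Subtype.ext ?_
    exact (ω.decompose_coeAddMonoidHom d s).symm.trans
      ((congrArg (ω.decompose R · s) h).trans (ω.decompose_coeAddMonoidHom d' s))
  · intro x
    have hx : x ∈ (⊤ : AddSubgroup (LeavittPathAlgebra R V)) := trivial
    rw [← closure_monomial] at hx
    induction hx using AddSubgroup.closure_induction with
    | zero => exact ⟨0, map_zero _⟩
    | neg x _ hx =>
      obtain ⟨d, rfl⟩ := hx
      exact ⟨-d, map_neg _ d⟩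
    | add x y _ _ hx hy =>
      obtain ⟨d, rfl⟩ := hx
      obtain ⟨d', rfl⟩ := hy
      exact ⟨d + d', map_add _ d d'⟩
    | mem x hx =>
      obtain ⟨r, a, b, c, μ, η, rfl⟩ := hx
      exact ⟨DirectSum.of (fun s => ω.component R s) (ω.path μ * ω.ghostPath η)
        ⟨monomial r μ η, AddSubgroup.subset_closure
          ⟨ω.path_mul_ghostPath_ne_zero μ η, r, a, b, c, μ, η, rfl, rfl⟩⟩,
        DirectSum.coeAddMonoidHom_of _ _ _⟩

/-- This makes the class of any word homogeneous of the weight of that word, so products of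
monomials need not be rewritten in the form `μη*`. -/
theorem mem_component_iff {s : BrandtSemigroup G I} {x : LeavittPathAlgebra R V} :
    x ∈ ω.component R s ↔ ω.decompose R x = Finsupp.single s x := by
  classical
  refine ⟨ω.decompose_of_mem, fun h => ?_⟩
  obtain ⟨d, rfl⟩ := ω.isInternal_component.2 x
  have hs := ω.decompose_coeAddMonoidHom d s
  rw [h, Finsupp.single_eq_same] at hs
  rw [hs]
  exact (d s).2

theorem mul_mem_component {s t : BrandtSemigroup G I} {x y : LeavittPathAlgebra R V}
    (hx : x ∈ ω.component R s) (hy : y ∈ ω.component R t) : x * y ∈ ω.component R (s * t) := by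
  refine AddSubgroup.mul_mem_of_closure ?_ hx hy
  rintro _ ⟨-, r, a, b, c, μ, η, rfl, rfl⟩ _ ⟨-, r', a', b', c', μ', η', rfl, rfl⟩
  rw [mem_component_iff, monomial_eq_wordTerm, monomial_eq_wordTerm, wordTerm_mul_wordTerm,
    decompose_wordTerm]
  simp only [map_mul, word_pathWord, word_ghostWord]

variable (R) in
/-- The weight map induces a grading. -/
theorem isGradedInducing : IsGradedInducing (ω.component R) where
  isInternal := ω.isInternal_component
  zero_component := ω.component_zero
  mul_mem _ _ _ _ := ω.mul_mem_component

end

/-! ### Graded regularity -/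

variable {I : Type y} {ω : WeightMap ℤ I V}

theorem IsCanonical.exists_path_eq (hω : ω.IsCanonical) {a b : V} (p : Quiver.Path a b) :
    ∃ i j : I, ω.path p = .triple i p.length j ∧ ω.ghostPath p = .triple j (-p.length) i := by
  induction p with
  | nil =>
    obtain ⟨i, hi⟩ := hω.vertex_form a
    exact ⟨i, i, hi, hi⟩
  | cons p e ih =>
    obtain ⟨i, j, hp, hg⟩ := ih
    obtain ⟨i', j', g', hj', hp', -⟩ := ω.exists_path_eq p
    obtain ⟨k, l, g, hk, he, -⟩ := ω.exists_edge_eq ⟨_, _, e⟩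
    obtain ⟨_, _, he'⟩ := hω.edge_form ⟨_, _, e⟩
    injection hp.symm.trans hp' with _ _ h₁
    injection hj'.symm.trans hk with h₂ _ _
    injection he.symm.trans he' with _ h₃ _
    subst h₁ h₂ h₃
    refine ⟨i, l, ?_, ?_⟩
    · rw [path, hp, he, BrandtSemigroup.triple_mul_triple, if_pos rfl, Quiver.Path.length_cons]
      push_cast; rfl
    · rw [ghostPath, hg, ω.ghost_eq, he, BrandtSemigroup.inv_triple,
        BrandtSemigroup.triple_mul_triple, if_pos rfl, Quiver.Path.length_cons]
      push_cast; rw [neg_add_rev]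

theorem IsCanonical.exists_mem_lengthFiltration (hω : ω.IsCanonical) {i j : I} {n : ℤ}
    {x : LeavittPathAlgebra R V} (hx : x ∈ ω.component R (.triple i n j)) :
    ∃ k, x ∈ lengthFiltration R V k n.toNat (-n).toNat := by
  induction hx using AddSubgroup.closure_induction with
  | zero => exact ⟨0, zero_mem _⟩
  | neg x _ hx =>
    obtain ⟨k, hk⟩ := hx
    exact ⟨k, neg_mem hk⟩
  | add x y _ _ hx hy =>
    obtain ⟨k, hk⟩ := hx
    obtain ⟨l, hl⟩ := hy
    exact ⟨max k l, add_mem (lengthFiltration_mono (le_max_left k l) _ _ hk)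
      (lengthFiltration_mono (le_max_right k l) _ _ hl)⟩
  | mem x hx =>
    obtain ⟨-, r, a, b, c, μ, η, hw, rfl⟩ := hx
    obtain ⟨i₁, j₁, hμ, -⟩ := hω.exists_path_eq μ
    obtain ⟨i₂, j₂, -, hη⟩ := hω.exists_path_eq η
    rw [hμ, hη, BrandtSemigroup.triple_mul_triple] at hw
    split_ifs at hw with hj
    · injection hw with _ hn _
      -- From `n = |μ| - |η|`, removing the minimum of the lengths leaves the positive part of `n`
      -- for `μ` and the negative part for `η`.
      exact ⟨min μ.length η.length, AddSubgroup.subset_closure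
        ⟨r, ⟨a, c, μ⟩, ⟨b, c, η⟩, min μ.length η.length, le_rfl,
          by simp only [AnyPath.length]; lia, by simp only [AnyPath.length]; lia, rfl⟩⟩

theorem IsCanonical.isGradedVonNeumannRegular (hω : ω.IsCanonical) (hR : IsVonNeumannRegular R) :
    IsGradedVonNeumannRegular (ω.component R) := by
  intro s x hx
  cases s with
  | zero =>
    obtain rfl : x = 0 := AddSubgroup.mem_bot.1 (ω.component_zero (R := R) ▸ hx)
    exact ⟨0, by simp⟩
  | triple i n j =>
    obtain ⟨k, hk⟩ := hω.exists_mem_lengthFiltration hx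
    obtain ⟨y, -, hy⟩ := isRegularPair_lengthFiltration hR k _ _ x hk
    exact ⟨y, hy⟩

end WeightMap

/-! ### A representation of the Leavitt path algebra -/

namespace LeavittPathAlgebra

open FreeSemigroup LeavittGen

variable {V : Type v} [Quiver.{w} V]

/-- Every edge acts injectively on `K` such that, for every vertex that is not a sink, `K` is the
disjoint union of the images of the edges emitted by it. -/
structure EdgeAction (V : Type v) [Quiver.{w} V] (K : Type*) where
  act : Quiver.Total V → K → K
  eq_of_act_eq : ∀ (e f : Quiver.Total V) (k l : K), e.left = f.left → act e k = act f l → e = f ∧ k = l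
  exists_act_eq : ∀ (e : Quiver.Total V) (k : K), ∃ f l, f.left = e.left ∧ act f l = k

variable (V) in
theorem exists_edgeAction :
    ∃ K : Type max v w, Nonempty K ∧ Nonempty (EdgeAction V K) := by
  -- The edges make `K` at least as large as any set of emitted edges, and `ℕ` makes it infinite and
  -- nonempty; so `EmittedEdge a × K ≃ K` unless `a` is a sink.
  let K := Quiver.Total V ⊕ ℕ
  have h : ∀ a : V, Nonempty (EmittedEdge a) → Nonempty (EmittedEdge a × K ≃ K) := fun a ha => by
    refine Cardinal.eq.1 ?_
    rw [Cardinal.mk_prod, Cardinal.lift_id, Cardinal.lift_id]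
    refine Cardinal.mul_eq_right (Cardinal.aleph0_le_mk K) ?_ (Cardinal.mk_ne_zero_iff.2 ha)
    exact Cardinal.mk_le_of_injective (f := fun e : EmittedEdge a => (.inl e.1 : K))
      fun e f hef => Subtype.ext (Sum.inl_injective hef)
  let σ (a : V) (ha : Nonempty (EmittedEdge a)) : EmittedEdge a × K ≃ K := (h a ha).some
  have hσ : ∀ (e : Quiver.Total V) (a : V) (ha : Nonempty (EmittedEdge a)) (he : e.left = a) (k : K),
      σ e.left ⟨⟨e, rfl⟩⟩ (⟨e, rfl⟩, k) = σ a ha (⟨e, he⟩, k) := by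
    rintro e _ _ rfl k
    rfl
  refine ⟨K, ⟨.inr 0⟩, ⟨⟨fun e k => σ e.left ⟨⟨e, rfl⟩⟩ (⟨e, rfl⟩, k), ?_, ?_⟩⟩⟩
  · intro e f k l hef hkl
    rw [hσ e f.left ⟨⟨f, rfl⟩⟩ hef k] at hkl
    have hp := (σ f.left ⟨⟨f, rfl⟩⟩).injective hkl
    exact ⟨congrArg (fun p => p.1.1) hp, congrArg Prod.snd hp⟩
  · intro e k
    obtain ⟨⟨⟨f, hf⟩, l⟩, rfl⟩ := (σ e.left ⟨⟨e, rfl⟩⟩).surjective k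
    exact ⟨f, l, hf, hσ f e.left ⟨⟨e, rfl⟩⟩ hf l⟩

namespace EdgeAction

variable {K : Type*} (α : EdgeAction V K) (R : Type u) [Ring R]

/-- The operators by which the generators act on the functions `V × K → R`. -/
noncomputable def gen : LeavittGen V → Module.End Rᵐᵒᵖ (V × K → R)
  | .vertex a => open Classical in
    { toFun f x := if x.1 = a then f x else 0
      map_add' f g := by ext x; by_cases h : x.1 = a <;> simp [h]
      map_smul' r f := by ext x; by_cases h : x.1 = a <;> simp [h] }
  | .edge e =>
    -- Transport along the injection `α.act e`, with value `0` off its image.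
    { toFun f := Function.extend (fun k => (e.left, α.act e k)) (fun k => f (e.right, k)) 0
      map_add' f g := by
        rw [← Function.extend_add, add_zero]; rfl
      map_smul' r f := by
        rw [RingHom.id_apply, ← Function.extend_smul, smul_zero]; rfl }
  | .ghost e => open Classical in
    { toFun f x := if x.1 = e.right then f (e.left, α.act e x.2) else 0
      map_add' f g := by ext x; by_cases h : x.1 = e.right <;> simp [h]
      map_smul' r f := by ext x; by_cases h : x.1 = e.right <;> simp [h] }

variable {R}

open Classical in
theorem gen_vertex_apply (a : V) (f : V × K → R) (x : V × K) :
    α.gen R (vertex a) f x = if x.1 = a then f x else 0 := rfl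

open Classical in
theorem gen_ghost_apply (e : Quiver.Total V) (f : V × K → R) (x : V × K) :
    α.gen R (ghost e) f x = if x.1 = e.right then f (e.left, α.act e x.2) else 0 := rfl

theorem gen_edge_eq (e : Quiver.Total V) (f : V × K → R) : α.gen R (edge e) f =
    Function.extend (fun k => (e.left, α.act e k)) (fun k => f (e.right, k)) 0 := rfl

theorem gen_edge_apply (e : Quiver.Total V) (f : V × K → R) (k : K) :
    α.gen R (edge e) f (e.left, α.act e k) = f (e.right, k) := by
  have h : Function.Injective fun k => (e.left, α.act e k) := fun k l h =>
    (α.eq_of_act_eq e e k l rfl (congrArg Prod.snd h)).2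
  rw [gen_edge_eq]
  exact h.extend_apply _ _ k

theorem gen_edge_apply_of_ne (e : Quiver.Total V) (f : V × K → R) (x : V × K)
    (h : ∀ k, (e.left, α.act e k) ≠ x) : α.gen R (edge e) f x = 0 := by
  rw [gen_edge_eq]
  exact Function.extend_apply' _ _ _ fun ⟨k, hk⟩ => h k hk

variable (R) in
/-- The operators by which words act. -/
noncomputable def word : FreeSemigroup (LeavittGen V) →ₙ* Module.End Rᵐᵒᵖ (V × K → R) :=
  FreeSemigroup.lift (α.gen R)

theorem word_of (g : LeavittGen V) : α.word R (of g) = α.gen R g := FreeSemigroup.lift_of _ g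

/-- Coefficients act by pointwise left multiplication. That they commute with the generators is what
makes `rep` multiplicative for noncommutative `R`. -/
theorem commute_word (r : R) (m : FreeSemigroup (LeavittGen V)) :
    Commute (Module.toModuleEnd Rᵐᵒᵖ (S := R) (V × K → R) r) (α.word R m) := by
  induction m using FreeSemigroup.recOnMul with
  | ih1 g =>
    rw [word_of]
    ext f x
    change r * α.gen R g f x = α.gen R g (r • f) x
    cases g with
    | vertex a => simp [gen_vertex_apply]
    | ghost e => simp [gen_ghost_apply]
    | edge e =>
      by_cases h : ∃ k, (e.left, α.act e k) = x
      · obtain ⟨k, rfl⟩ := h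
        rw [gen_edge_apply, gen_edge_apply]; rfl
      · push Not at h
        rw [gen_edge_apply_of_ne _ _ _ _ h, gen_edge_apply_of_ne _ _ _ _ h, mul_zero]
  | ih2 g m hg hm => rw [map_mul]; exact hg.mul_right hm

variable (R) in
/-- The action of the free ring. -/
noncomputable def rep : LeavittFree R V →ₙ+* Module.End Rᵐᵒᵖ (V × K → R) where
  __ := MonoidAlgebra.liftNC
    (Module.toModuleEnd Rᵐᵒᵖ (S := R) (V × K → R) : R →+ Module.End Rᵐᵒᵖ (V × K → R)) (α.word R)
  map_mul' x y := MonoidAlgebra.liftNC_mul (Module.toModuleEnd Rᵐᵒᵖ (S := R) (V × K → R))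
    (α.word R) x y fun _ => α.commute_word _ _

theorem rep_single (m : FreeSemigroup (LeavittGen V)) (r : R) (f : V × K → R) (x : V × K) :
    α.rep R (MonoidAlgebra.single m r) f x = r * α.word R m f x :=
  congrFun (LinearMap.congr_fun (MonoidAlgebra.liftNC_single
    (Module.toModuleEnd Rᵐᵒᵖ (S := R) (V × K → R) : R →+ Module.End Rᵐᵒᵖ (V × K → R))
    (α.word R) m r) f) x

theorem word_mul_of (g h : LeavittGen V) (f : V × K → R) :
    α.word R (of g * of h) f = α.gen R g (α.gen R h f) := by
  rw [map_mul, word_of, word_of]; rfl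

variable (R) in
-- Relation (3) reflects injectivity and disjointness of the images of the edges. Relation (4)
-- reflects that these images cover `K` at a regular vertex.
theorem leavittCon_le : leavittCon R V ≤ RingCon.comap (⊥ : RingCon _) (α.rep R) := by
  refine RingCon.ringConGen_le.2 fun x y h => ?_
  change α.rep R x = α.rep R y
  cases h with
  | vertex_mul_self r a =>
    ext f x
    rw [rep_single, rep_single, word_mul_of, word_of]
    by_cases h : x.1 = a <;> simp [gen_vertex_apply, h]
  | vertex_mul_vertex r a b h =>
    ext f x
    rw [rep_single, word_mul_of, map_zero]
    by_cases h' : x.1 = a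
    · simp [gen_vertex_apply, h', h]
    · simp [gen_vertex_apply, h']
  | source_mul_edge r e =>
    ext f x
    rw [rep_single, rep_single, word_mul_of, word_of, gen_vertex_apply]
    by_cases h : x.1 = e.left
    · rw [if_pos h]
    · rw [if_neg h, gen_edge_apply_of_ne]
      rintro k rfl
      exact h rfl
  | edge_mul_range r e =>
    ext f x
    rw [rep_single, rep_single, word_mul_of, word_of]
    by_cases h : ∃ k, (e.left, α.act e k) = x
    · obtain ⟨k, rfl⟩ := h
      rw [gen_edge_apply, gen_edge_apply, gen_vertex_apply, if_pos rfl]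
    · push Not at h
      rw [gen_edge_apply_of_ne _ _ _ _ h, gen_edge_apply_of_ne _ _ _ _ h]
  | range_mul_ghost r e =>
    ext f x
    rw [rep_single, rep_single, word_mul_of, word_of]
    by_cases h : x.1 = e.right <;> simp [gen_vertex_apply, gen_ghost_apply, h]
  | ghost_mul_source r e =>
    ext f x
    rw [rep_single, rep_single, word_mul_of, word_of]
    by_cases h : x.1 = e.right <;> simp [gen_vertex_apply, gen_ghost_apply, h]
  | ghost_mul_edge_self r e =>
    ext f x
    rw [rep_single, rep_single, word_mul_of, word_of, gen_ghost_apply, gen_vertex_apply,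
      gen_edge_apply]
    obtain ⟨a, k⟩ := x
    by_cases h : a = e.right <;> simp [h]
  | ghost_mul_edge r e e' h =>
    ext f x
    rw [rep_single, word_mul_of, map_zero, gen_ghost_apply, gen_edge_apply_of_ne]
    · simp
    · intro k hk
      exact h (α.eq_of_act_eq _ _ _ _ (congrArg Prod.fst hk) (congrArg Prod.snd hk)).1.symm
  | @sum_edge_mul_ghost r a h _ =>
    ext f x
    rw [map_sum, rep_single, LinearMap.sum_apply, Finset.sum_apply]
    simp only [rep_single, word_mul_of, word_of]
    rw [← Finset.mul_sum]
    congr 1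
    obtain ⟨b, k⟩ := x
    rw [gen_vertex_apply]
    by_cases hb : b = a
    · subst hb
      obtain ⟨⟨e₀, rfl⟩⟩ := h.1
      obtain ⟨e, l, he, rfl⟩ := α.exists_act_eq e₀ k
      -- Exactly one emitted edge has the given point in its image; the other summands vanish there.
      rw [if_pos rfl, Finset.sum_eq_single ⟨e, he⟩]
      · change α.gen R (edge e) (α.gen R (ghost e) f) _ = _
        rw [← he, gen_edge_apply, gen_ghost_apply, if_pos rfl]
      · rintro ⟨e', he'⟩ _ hne
        refine gen_edge_apply_of_ne _ _ _ _ fun k' hk => hne (Subtype.ext ?_)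
        exact (α.eq_of_act_eq _ _ _ _ (he'.trans he.symm) (congrArg Prod.snd hk)).1
      · exact fun h => (h (Finset.mem_univ _)).elim
    · rw [if_neg hb]
      refine Finset.sum_eq_zero fun e _ => gen_edge_apply_of_ne _ _ _ _ fun k' hk => hb ?_
      exact (congrArg Prod.fst hk).symm.trans e.2

end EdgeAction

/-- The coefficient of a vertex can be recovered up to von Neumann inverses: if `r v` is von Neumann
regular in the Leavitt path algebra, then `r` is so in `R`. -/
theorem exists_eq_mul_mul_of_vertex {R : Type u} [Ring R] {r : R} {a : V}
    {y : LeavittPathAlgebra R V}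
    (h : wordTerm R (of (vertex a)) r =
      wordTerm R (of (vertex a)) r * y * wordTerm R (of (vertex a)) r) :
    ∃ s : R, r = r * s * r := by
  obtain ⟨K, ⟨k⟩, ⟨α⟩⟩ := exists_edgeAction V
  obtain ⟨y, rfl⟩ := Quotient.exists_rep y
  classical
  have h₁ := α.leavittCon_le R ((RingCon.eq _).1 h)
  replace h₁ : α.rep R _ = α.rep R _ := h₁
  rw [map_mul, map_mul] at h₁
  let δ : V × K → R := Pi.single (a, k) 1
  -- On `δ`, left multiplication by `r` agrees with right multiplication, which commutes with the
  -- action of `y`. So `r` can be pulled out on the right, and `s` is the value of `y δ` at `(a,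
  -- k)`.
  have h₂ : α.rep R (MonoidAlgebra.single (of (vertex a)) r) δ = MulOpposite.op r • δ := by
    ext x
    rw [α.rep_single, α.word_of, α.gen_vertex_apply]
    by_cases hx : x = (a, k)
    · subst hx; simp [δ]
    · simp [δ, hx]
  have h₃ := congrFun (LinearMap.congr_fun h₁ δ) (a, k)
  rw [Module.End.mul_apply, Module.End.mul_apply, h₂, map_smul, α.rep_single, α.word_of,
    α.gen_vertex_apply, if_pos rfl] at h₃
  refine ⟨α.rep R y δ (a, k), ?_⟩
  simpa [δ, mul_assoc] using h₃

end LeavittPathAlgebra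

theorem WeightMap.isVonNeumannRegular {R : Type u} [Ring R] {V : Type v} [Quiver.{w} V]
    [Nonempty V] {G : Type x} [AddGroup G] {I : Type y} (ω : WeightMap G I V)
    (h : IsGradedVonNeumannRegular (ω.component R)) : IsVonNeumannRegular R := by
  intro r
  obtain ⟨a⟩ := ‹Nonempty V›
  obtain ⟨y, hy⟩ := h (ω.vertex a) (LeavittPathAlgebra.wordTerm R (.of (.vertex a)) r)
    (ω.mem_component_iff.2 (ω.decompose_wordTerm _ _))
  exact LeavittPathAlgebra.exists_eq_mul_mul_of_vertex hy

theorem mainTheorem1 (R : Type u) [Ring R] (V : Type v) [Quiver.{w} V] [Nonempty V] (I : Type y)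
    (ω : WeightMap ℤ I V) (hω : ω.IsCanonical) :
    IsGradedInducing (ω.component R) ∧
      (IsGradedVonNeumannRegular (ω.component R) ↔ IsVonNeumannRegular R) := by
  exact ⟨ω.isGradedInducing R, ω.isVonNeumannRegular, hω.isGradedVonNeumannRegular⟩
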